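/- **Lemma (constant propagation is a lock-step simulation).** RTL is an intermediate language whose functions consist of a signature, parameters, a stack size, an entry point and a control-flow graph, i.e. a finite map from labels $l$ to instructions $\mathtt{nop}$, $\mathtt{op}$, $\mathtt{load}$, $\mathtt{store}$, $\mathtt{call}$, $\mathtt{tailcall}$, $\mathtt{cond}$, $\mathtt{return}$ over pseudo-registers. Values are 32-bit integers, 64-bit IEEE floats, pointers $\mathtt{ptr}(b,\delta)$ and $\mathtt{undef}$. Its semantics is a transition relation $G \vdash S \xrightarrow{t} S'$, where $G$ is the global environment of the program, $t$ is a trace of external calls, and states $S$ are regular states $\mathcal S(\Sigma,g,\sigma,l,R,M)$, call states $\mathcal C(\Sigma,\mathit{Fd},\vec v,M)$ or return states $\mathcal R(\Sigma,v,M)$; here $\Sigma$ is a list of stack frames $\mathcal F(r,g,\sigma,l,R)$, $g$ a control-flow graph, $\sigma$ a stack block, $R$ a register state and $M$ a memory state. $P \Downarrow B$ means that program $P$ has the observable behavior $B$ (termination with a trace and an exit code, divergence with a trace, or going wrong after a trace). *Analysis.* Abstract values are $\top$, $\bot$, $\mathtt{Int}(n)$, $\mathtt{Float}(f)$ and $\mathtt{Addrsymbol}(id+\delta)$,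 with the flat order; abstract register states map registers to abstract values, ordered pointwise. The transfer function $T_F(l,a)$ is $a\{r\leftarrow\overline{\mathtt{eval\_op}}(op,a(\vec r))\}$ if $F.\mathtt{code}(l)$ is an $\mathtt{op}$ instruction with operator $op$, arguments $\vec r$ and result $r$; it is $a\{r\leftarrow\top\}$ if $F.\mathtt{code}(l)$ is a $\mathtt{load}$ or a $\mathtt{call}$ with result $r$; and $a$ otherwise. Here $\overline{\mathtt{eval\_op}}$ is the abstract interpretation of operator evaluation. $\mathtt{analyze}(F)$ is the solution that Kildall's worklist algorithm, run for at most $N$ iterations, finds for the inequations $A(s)\ge T_F(l,A(l))$ (for all successors $s$ of $l$) and $A(F.\mathtt{entrypoint})\ge(r\mapsto\top)$; if it finds none, $\mathtt{analyze}(F)(l)=(r\mapsto\top)$ for all $l$. *Transformation.* The transformed function $\mathtt{transf}(F)$ is $F$ with each instruction at $l$ rewritten according to $\mathtt{analyze}(F)(l)$: an $\mathtt{op}$ whose result is statically known becomes a load of that constant; a $\mathtt{cond}$ whose outcome is statically known becomes a $\mathtt{nop}$ to the corresponding successor; other operators, conditions and addressing modes are specialized to cheaper immediate forms when some argument is statically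 known. It is extended to function definitions $\mathit{Fd}$ (leaving external functions unchanged) and to programs. *Invariant.* Agreement $\models v : a$ of a value with an abstract value is given by $\models v:\top$, $\models\mathtt{int}(n):\mathtt{Int}(n)$, $\models\mathtt{float}(f):\mathtt{Float}(f)$, and $\models\mathtt{ptr}(b,\delta):\mathtt{Addrsymbol}(id+\delta)$ if $G$ maps the symbol $id$ to the block $b$; $\models R:A$ means $\models R(r):A(r)$ for all registers $r$. The relation $\sim$ is generated by: * $\mathcal S(\Sigma,F.\mathtt{code},\sigma,l,R,M)\sim\mathcal S(\Sigma',F'.\mathtt{code},\sigma,l,R,M)$ if $\mathtt{transf}(F)=F'$, $\Sigma\sim\Sigma'$ and $\models R:\mathtt{analyze}(F)(l)$; * $\mathcal C(\Sigma,\mathit{Fd},\vec v,M)\sim\mathcal C(\Sigma',\mathit{Fd}',\vec v,M)$ if $\mathtt{transf}(\mathit{Fd})=\mathit{Fd}'$ and $\Sigma\sim\Sigma'$; * $\mathcal R(\Sigma,v,M)\sim\mathcal R(\Sigma',v,M)$ if $\Sigma\sim\Sigma'$; * $\epsilon\sim\epsilon$ for empty stacks, and $\mathcal F(r,F.\mathtt{code},\sigma,l,R).\Sigma\sim\mathcal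 F(r,F'.\mathtt{code},\sigma,l,R).\Sigma'$ if $\mathtt{transf}(F)=F'$, $\Sigma\sim\Sigma'$ and, for every value $v$, $\models R\{r\leftarrow v\}:\mathtt{analyze}(F)(l)$. *Claim.* Let $N$ be any iteration bound, $P$ an RTL program, $P'$ its transform, and $G$, $G'$ their global environments. Then: 1. every initial state of $P$ is related by $\sim$ to every initial state of $P'$; 2. if $S\sim S'$ and $S$ is final with exit code $n$, then $S'$ is final with exit code $n$; 3. if $G\vdash S_1\xrightarrow{t}S_2$ and $S_1\sim S_1'$, there exists $S_2'$ such that $G'\vdash S_1'\xrightarrow{t}S_2'$ and $S_2\sim S_2'$. Hence, for every behavior $B$ that is not a going-wrong behavior, $P\Downarrow B$ implies $P'\Downarrow B$. -/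

import Mathlib

namespace CompCert

/-! ## Identifiers, labels, machine integers -/

/-- Global identifiers. -/
abbrev Ident := ℕ
/-- Pseudo-registers (unlimited supply). -/
abbrev Reg := ℕ
/-- Labels of control-flow graph nodes. -/
abbrev Node := ℕ
/-- Memory block identifiers. -/
abbrev Block := ℤ
/-- 32-bit machine integers. -/
abbrev I32 := BitVec 32

/-- Comparisons. -/
inductive Comparison
  | eq | ne | gt | ge | lt | le

namespace Comparison

/-- The comparison obtained by exchanging the two arguments. -/
def swap : Comparison → Comparison
  | eq => eq | ne => ne | gt => lt | ge => le | lt => gt | le => ge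

/-- Signed integer comparison. -/
def evalS (c : Comparison) (x y : I32) : Bool :=
  match c with
  | eq => decide (x = y)
  | ne => decide (x ≠ y)
  | gt => decide (y.toInt < x.toInt)
  | ge => decide (y.toInt ≤ x.toInt)
  | lt => decide (x.toInt < y.toInt)
  | le => decide (x.toInt ≤ y.toInt)

/-- Unsigned integer comparison. -/
def evalU (c : Comparison) (x y : I32) : Bool :=
  match c with
  | eq => decide (x = y)
  | ne => decide (x ≠ y)
  | gt => decide (y.toNat < x.toNat)
  | ge => decide (y.toNat ≤ x.toNat)
  | lt => decide (x.toNat < y.toNat)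
  | le => decide (x.toNat ≤ y.toNat)

end Comparison

namespace I32

def ofBool (b : Bool) : I32 := if b then 1#32 else 0#32
def signExt (k : ℕ) (x : I32) : I32 := (x.setWidth k).signExtend 32
def zeroExt (k : ℕ) (x : I32) : I32 := (x.setWidth k).setWidth 32
/-- Signed and unsigned division, undefined when the divisor is zero. -/
def div (x y : I32) : Option I32 := if y = 0#32 then none else some (x.sdiv y)
def divu (x y : I32) : Option I32 := if y = 0#32 then none else some (x.udiv y)
/-- Shifts, undefined when the shift amount is not less than the word size. -/
def shl (x y : I32) : Option I32 := if y.toNat < 32 then some (x <<< y.toNat) else none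
def shr (x y : I32) : Option I32 := if y.toNat < 32 then some (x.sshiftRight y.toNat) else none
def shru (x y : I32) : Option I32 := if y.toNat < 32 then some (x >>> y.toNat) else none
/-- Signed division by `2 ^ y`, rounding towards zero, for `y < 31`. -/
def shrx (x y : I32) : Option I32 :=
  if y.toNat < 31 then some (x.sdiv (1#32 <<< y.toNat)) else none
/-- Rotate left, then mask. -/
def rolm (x amount mask : I32) : I32 := x.rotateLeft amount.toNat &&& mask
/-- The logarithm in base two of a power of two. -/
def log2? (x : I32) : Option I32 :=
  if x.toNat = 2 ^ Nat.log 2 x.toNat then some (BitVec.ofNat 32 (Nat.log 2 x.toNat)) else none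

end I32

/-! ## IEEE 754 double-precision floating-point numbers -/

/-- A double-precision number, by its bit pattern: 1 sign bit, 11 exponent bits, 52 fraction
bits. -/
structure F64 where
  bits : BitVec 64
deriving DecidableEq

namespace F64

def sign (x : F64) : Bool := x.bits.msb
def expo (x : F64) : ℕ := (x.bits.extractLsb' 52 11).toNat
def frac (x : F64) : ℕ := (x.bits.extractLsb' 0 52).toNat
def isNaN (x : F64) : Bool := decide (x.expo = 2047 ∧ x.frac ≠ 0)
def isInf (x : F64) : Bool := decide (x.expo = 2047 ∧ x.frac = 0)

/-- Absolute value of a finite number, as a rational. -/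
def mag (x : F64) : ℚ :=
  if x.expo = 0 then (x.frac : ℚ) * (2 : ℚ) ^ (-1074 : ℤ)
  else ((2 : ℚ) ^ 52 + (x.frac : ℚ)) * (2 : ℚ) ^ ((x.expo : ℤ) - 1075)

/-- Value of a finite number, as a rational. -/
def toRat (x : F64) : ℚ := if x.sign then -x.mag else x.mag

/-- Assemble a number from its sign, biased exponent and fraction. -/
def pack (s : Bool) (e f : ℕ) : F64 :=
  ⟨BitVec.ofNat 64 ((if s then 2 ^ 63 else 0) + e * 2 ^ 52 + f)⟩

def inf (s : Bool) : F64 := pack s 2047 0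
def zero (s : Bool) : F64 := pack s 0 0
/-- The quiet NaN returned by the arithmetic operations. -/
def nan : F64 := pack false 2047 (2 ^ 51)

/-- Rounding to the nearest integer, ties to even. -/
def roundEven (q : ℚ) : ℤ :=
  if q - (⌊q⌋ : ℚ) < 1 / 2 then ⌊q⌋
  else if 1 / 2 < q - (⌊q⌋ : ℚ) then ⌊q⌋ + 1
  else if Even ⌊q⌋ then ⌊q⌋ else ⌊q⌋ + 1

/-- Rounding of a nonnegative rational to `p` significant bits, in multiples of `2 ^ emin`. -/
def roundMag (p : ℕ) (emin : ℤ) (q : ℚ) : ℚ :=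
  (roundEven (q / (2 : ℚ) ^ max emin (Int.log 2 q + 1 - (p : ℤ))) : ℚ) *
    (2 : ℚ) ^ max emin (Int.log 2 q + 1 - (p : ℤ))

/-- The number with sign `s` whose absolute value is the representable rational `q`, or an
infinity if `q` is too large. -/
def ofMag (s : Bool) (q : ℚ) : F64 :=
  if (2 : ℚ) ^ 1024 ≤ q then inf s
  else if q < (2 : ℚ) ^ (-1022 : ℤ) then pack s 0 (q * (2 : ℚ) ^ 1074).num.toNat
  else pack s (Int.log 2 q + 1023).toNat
    ((q / (2 : ℚ) ^ (Int.log 2 q - 52)).num.toNat - 2 ^ 52)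

/-- Rounding of a nonzero rational to nearest, ties to even. -/
def ofRat (q : ℚ) : F64 := ofMag (decide (q < 0)) (roundMag 53 (-1074) |q|)

def neg (x : F64) : F64 := ⟨x.bits ^^^ BitVec.ofNat 64 (2 ^ 63)⟩
def abs (x : F64) : F64 := ⟨x.bits &&& BitVec.ofNat 64 (2 ^ 63 - 1)⟩

def add (x y : F64) : F64 :=
  if x.isNaN || y.isNaN then nan
  else if x.isInf then (if y.isInf && (x.sign != y.sign) then nan else x)
  else if y.isInf then y
  else if x.toRat + y.toRat = 0 then zero (x.sign && y.sign)
  else ofRat (x.toRat + y.toRat)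

def sub (x y : F64) : F64 := add x (neg y)

def mul (x y : F64) : F64 :=
  if x.isNaN || y.isNaN then nan
  else if x.isInf || y.isInf then
    (if (!x.isInf && decide (x.mag = 0)) || (!y.isInf && decide (y.mag = 0)) then nan
     else inf (x.sign != y.sign))
  else ofMag (x.sign != y.sign) (roundMag 53 (-1074) (x.mag * y.mag))

def div (x y : F64) : F64 :=
  if x.isNaN || y.isNaN then nan
  else if x.isInf then (if y.isInf then nan else inf (x.sign != y.sign))
  else if y.isInf then zero (x.sign != y.sign)
  else if y.mag = 0 then (if x.mag = 0 then nan else inf (x.sign != y.sign))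
  else ofMag (x.sign != y.sign) (roundMag 53 (-1074) (x.mag / y.mag))

/-- Rounding to single precision; the result is again viewed as a double. -/
def toSingle (x : F64) : F64 :=
  if x.isNaN then nan
  else if x.isInf then x
  else if (2 : ℚ) ^ 128 ≤ roundMag 24 (-149) x.mag then inf x.sign
  else ofMag x.sign (roundMag 24 (-149) x.mag)

/-- Strict order on numbers; false when an argument is a NaN. -/
def blt (x y : F64) : Bool :=
  if x.isNaN || y.isNaN then false
  else if x.isInf then x.sign && !(y.isInf && y.sign)
  else if y.isInf then !y.sign
  else decide (x.toRat < y.toRat)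

/-- Numerical equality; false when an argument is a NaN. -/
def beq (x y : F64) : Bool :=
  if x.isNaN || y.isNaN then false
  else if x.isInf || y.isInf then x.isInf && y.isInf && (x.sign == y.sign)
  else decide (x.toRat = y.toRat)

def cmp (c : Comparison) (x y : F64) : Bool :=
  match c with
  | .eq => beq x y
  | .ne => !beq x y
  | .gt => blt y x
  | .ge => blt y x || beq x y
  | .lt => blt x y
  | .le => blt x y || beq x y

/-- Truncation of a finite number towards zero. -/
def trunc (x : F64) : ℤ := if x.sign then -⌊x.mag⌋ else ⌊x.mag⌋

/-- Conversions to integers, undefined when the truncated value is not representable. -/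
def toI32 (x : F64) : Option I32 :=
  if x.isNaN || x.isInf then none
  else if -2 ^ 31 ≤ x.trunc ∧ x.trunc < 2 ^ 31 then some (BitVec.ofInt 32 x.trunc) else none
def toU32 (x : F64) : Option I32 :=
  if x.isNaN || x.isInf then none
  else if 0 ≤ x.trunc ∧ x.trunc < 2 ^ 32 then some (BitVec.ofInt 32 x.trunc) else none
/-- Conversions from integers (exact). -/
def ofI32 (n : I32) : F64 := if n = 0#32 then zero false else ofRat (n.toInt : ℚ)
def ofU32 (n : I32) : F64 := if n = 0#32 then zero false else ofRat (n.toNat : ℚ)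

end F64

/-! ## Values, memory states -/

inductive Val
  | int (n : I32)
  | float (f : F64)
  | ptr (b : Block) (δ : I32)
  | undef
deriving DecidableEq

/-- Memory quantities. -/
inductive Chunk
  | int8signed | int8unsigned | int16signed | int16unsigned | int32 | float32 | float64

def Chunk.size : Chunk → ℕ
  | int8signed => 1 | int8unsigned => 1 | int16signed => 2 | int16unsigned => 2
  | int32 => 4 | float32 => 4 | float64 => 8

/-- Truncation or extension of a value as prescribed by a memory quantity. -/
def Chunk.cast : Chunk → Val → Val
  | int8signed, .int n => .int (I32.signExt 8 n)
  | int8unsigned, .int n => .int (I32.zeroExt 8 n)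
  | int16signed, .int n => .int (I32.signExt 16 n)
  | int16unsigned, .int n => .int (I32.zeroExt 16 n)
  | int32, .int n => .int n
  | int32, .ptr b δ => .ptr b δ
  | float32, .float f => .float f.toSingle
  | float64, .float f => .float f
  | _, _ => .undef

/-- Contents of a byte offset: nothing known, the first byte of a datum of the given size, or a
later byte of a datum. -/
inductive Content
  | undef
  | datum (size : ℕ) (v : Val)
  | cont
deriving DecidableEq

structure Mem where
  /-- First block not yet allocated. -/
  next : Block
  lo : Block → ℤ
  hi : Block → ℤ
  /-- Allocated and not freed. -/
  live : Block → Bool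
  contents : Block → ℤ → Content

namespace Mem

def empty : Mem := ⟨1, fun _ => 0, fun _ => 0, fun _ => false, fun _ _ => .undef⟩

def alloc (M : Mem) (l h : ℤ) : Block × Mem :=
  (M.next,
   { next := M.next + 1
     lo := Function.update M.lo M.next l
     hi := Function.update M.hi M.next h
     live := Function.update M.live M.next true
     contents := Function.update M.contents M.next (fun _ => .undef) })

def free (M : Mem) (b : Block) : Mem := { M with live := Function.update M.live b false }

/-- The bytes `[δ, δ + size κ)` of block `b` may be accessed. -/
def Valid (M : Mem) (κ : Chunk) (b : Block) (δ : ℤ) : Prop :=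
  M.live b = true ∧ M.lo b ≤ δ ∧ δ + κ.size ≤ M.hi b

instance (M : Mem) (κ : Chunk) (b : Block) (δ : ℤ) : Decidable (M.Valid κ b δ) :=
  inferInstanceAs (Decidable (_ ∧ _ ∧ _))

def load (M : Mem) (κ : Chunk) (b : Block) (δ : ℤ) : Option Val :=
  if M.Valid κ b δ then
    match M.contents b δ with
    | .datum n v =>
      if n = κ.size ∧ ∀ i < κ.size - 1, M.contents b (δ + 1 + (i : ℤ)) = .cont
      then some (κ.cast v) else some .undef
    | _ => some .undef
  else none

def store (M : Mem) (κ : Chunk) (b : Block) (δ : ℤ) (v : Val) : Option Mem :=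
  if M.Valid κ b δ then
    some { M with
      contents := Function.update M.contents b (fun x =>
        if x = δ then .datum κ.size v
        else if δ < x ∧ x < δ + κ.size then .cont
        else M.contents b x) }
  else none

end Mem

/-! ## Programs -/

inductive Typ
  | int | float

structure Signature where
  args : List Typ
  /-- `none` stands for `void`. -/
  res : Option Typ

/-- External functions. -/
structure ExtFun where
  tag : Ident
  sig : Signature

/-- Initialization data for global variables. -/
inductive InitData
  | reserve (n : ℕ)
  | int8 (n : I32)
  | int16 (n : I32)
  | int32 (n : I32)
  | float32 (f : F64)
  | float64 (f : F64)

/-- Function definitions, for a type `F` of internal functions. -/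
inductive FunDef (F : Type)
  | internal (f : F)
  | external (fe : ExtFun)

structure Program (F : Type) where
  vars : List (Ident × List InitData)
  functs : List (Ident × FunDef F)
  main : Ident

/-- Extension of a transformation of internal functions to function definitions. -/
def transfFunDef {F₁ F₂ : Type} (transf : F₁ → Except String F₂) :
    FunDef F₁ → Except String (FunDef F₂)
  | .internal f => (transf f).map .internal
  | .external fe => .ok (.external fe)

/-- Extension of a transformation to the functions of a program. -/
def transfFunctions {F₁ F₂ : Type} (transf : F₁ → Except String F₂) :
    List (Ident × FunDef F₁) → Except String (List (Ident × FunDef F₂))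
  | [] => .ok []
  | (id, fd) :: fs =>
    (transfFunDef transf fd).bind fun fd' =>
      (transfFunctions transf fs).map fun fs' => (id, fd') :: fs'

/-- Extension of a transformation to whole programs. -/
def transfProgram {F₁ F₂ : Type} (transf : F₁ → Except String F₂) (P : Program F₁) :
    Except String (Program F₂) :=
  (transfFunctions transf P.functs).map fun fs =>
    { vars := P.vars, functs := fs, main := P.main }

/-! ## Global environments -/

structure GlobalEnv (F : Type) where
  funct : Block → Option (FunDef F)
  symbol : Ident → Option Block

/-- The `i`-th function (from 0) is at block `-(i + 1)`, the `i`-th variable at block `i + 1`. -/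
def globalenv {F : Type} (P : Program F) : GlobalEnv F where
  funct b := if b < 0 then (P.functs[(-b - 1).toNat]?).map Prod.snd else none
  symbol id :=
    match P.functs.findIdx? (fun p => p.1 == id) with
    | some i => some (-((i : ℤ) + 1))
    | none => (P.vars.findIdx? (fun p => p.1 == id)).map fun i => (i : ℤ) + 1

def InitData.size : InitData → ℕ
  | reserve n => n | int8 _ => 1 | int16 _ => 2 | int32 _ => 4 | float32 _ => 4 | float64 _ => 8

/-- Write one initialization datum. -/
def InitData.write (M : Mem) (b : Block) (δ : ℤ) : InitData → Mem
  | reserve _ => M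
  | int8 n => (M.store .int8unsigned b δ (.int n)).getD M
  | int16 n => (M.store .int16unsigned b δ (.int n)).getD M
  | int32 n => (M.store .int32 b δ (.int n)).getD M
  | float32 f => (M.store .float32 b δ (.float f)).getD M
  | float64 f => (M.store .float64 b δ (.float f)).getD M

/-- Write a sequence of initialization data from offset `δ` on. -/
def InitData.writeAll (b : Block) : Mem → ℤ → List InitData → Mem
  | M, _, [] => M
  | M, δ, d :: ds => InitData.writeAll b (InitData.write M b δ d) (δ + d.size) ds

/-- Initial memory state: the variables are allocated in order, at blocks 1, 2, ... -/
def initmem {F : Type} (P : Program F) : Mem :=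
  P.vars.foldl
    (fun M x =>
      InitData.writeAll (M.alloc 0 ((x.2.map InitData.size).sum : ℕ)).1
        (M.alloc 0 ((x.2.map InitData.size).sum : ℕ)).2 0 x.2)
    Mem.empty

/-! ## Traces, transition semantics, behaviors -/

inductive EventVal
  | int (n : I32)
  | float (f : F64)

def EventVal.toVal : EventVal → Val
  | int n => .int n
  | float f => .float f

def EventVal.typ : EventVal → Typ
  | int _ => .int
  | float _ => .float

/-- Invocation of an external function: its name, the arguments, the result. -/
structure Event where
  tag : Ident
  args : List EventVal
  res : EventVal

abbrev Trace := List Event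
/-- Finite or infinite traces. -/
abbrev TraceInf := Stream'.Seq Event

/-- Effect of applying an external function. The result of a `void` function is an integer. -/
inductive ExtCall (fe : ExtFun) : List Val → Trace → Val → Prop
  | intro (args : List EventVal) (res : EventVal)
      (hargs : args.map EventVal.typ = fe.sig.args)
      (hres : res.typ = fe.sig.res.getD .int) :
      ExtCall fe (args.map EventVal.toVal) [⟨fe.tag, args, res⟩] res.toVal

/-- The transition system associated with a program. -/
structure TransSem where
  State : Type
  step : State → Trace → State → Prop
  initial : State → Prop
  final : State → I32 → Prop

namespace TransSem

/-- Zero, one or several transitions. -/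
inductive Star (L : TransSem) : L.State → Trace → L.State → Prop
  | refl (S : L.State) : Star L S [] S
  | step {S S' S'' : L.State} {t₁ t₂ : Trace} :
      L.step S t₁ S' → Star L S' t₂ S'' → Star L S (t₁ ++ t₂) S''

/-- Infinite sequences of transitions: the greatest relation `X` such that `X S T` implies
`S → S'` with trace `t`, `T = t.T'` and `X S' T'` for some `t`, `S'`, `T'`. -/
def Forever (L : TransSem) (S : L.State) (T : TraceInf) : Prop :=
  ∃ X : L.State → TraceInf → Prop, X S T ∧
    ∀ S T, X S T → ∃ t S' T', L.step S t S' ∧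
      T = Stream'.Seq.append (Stream'.Seq.ofList t) T' ∧ X S' T'

end TransSem

inductive Behavior
  | converges (t : Trace) (n : I32)
  | diverges (T : TraceInf)
  | goeswrong (t : Trace)

/-- The set of "going wrong" behaviors. -/
def Wrong : Set Behavior := {B | ∃ t, B = .goeswrong t}

/-- Observable behaviors of a program. -/
inductive TransSem.Behaves (L : TransSem) : Behavior → Prop
  | converges {S S' : L.State} {t : Trace} {n : I32} :
      L.initial S → L.Star S t S' → L.final S' n → Behaves L (.converges t n)
  | diverges {S : L.State} {T : TraceInf} :
      L.initial S → L.Forever S T → Behaves L (.diverges T)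
  | goeswrong {S S' : L.State} {t : Trace} :
      L.initial S → L.Star S t S' → (∀ t' S'', ¬ L.step S' t' S'') → (∀ n, ¬ L.final S' n) →
      Behaves L (.goeswrong t)

/-! ## Operators, conditions, addressing modes -/

/-- Conditions. -/
inductive Condition
  | comp (c : Comparison)
  | compimm (c : Comparison) (n : I32)
  | compu (c : Comparison)
  | compuimm (c : Comparison) (n : I32)
  | compf (c : Comparison)

/-- Operators. -/
inductive Operation
  | move
  | intconst (n : I32)
  | floatconst (f : F64)
  | addrsymbol (id : Ident) (δ : I32)
  | addrstack (δ : I32)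
  | cast8s | cast8u | cast16s | cast16u
  | negint | notbool
  | add | addi (n : I32)
  /-- `subi n` computes `n - x`. -/
  | sub | subi (n : I32)
  | mul | muli (n : I32)
  | div | divu
  | and | andi (n : I32)
  | or | ori (n : I32)
  | xor | xori (n : I32)
  | nand | nor | nxor
  | shl | shr | shri (n : I32) | shrxi (n : I32) | shru
  | rolm (amount mask : I32)
  | negf | absf | addf | subf | mulf | divf
  | singleoffloat | intoffloat | intuoffloat | floatofint | floatofintu
  | cmp (c : Condition)

/-- Addressing modes. -/
inductive Mode
  | indexed (n : I32)
  | indexed2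
  | global (id : Ident) (δ : I32)
  | based (id : Ident) (δ : I32)
  | stack (δ : I32)

namespace Val

def intUn (f : I32 → I32) : Val → Option Val
  | int n => some (int (f n))
  | _ => none

def intUn? (f : I32 → Option I32) : Val → Option Val
  | int n => (f n).map int
  | _ => none

def intBin (f : I32 → I32 → I32) : Val → Val → Option Val
  | int n, int m => some (int (f n m))
  | _, _ => none

def intBin? (f : I32 → I32 → Option I32) : Val → Val → Option Val
  | int n, int m => (f n m).map int
  | _, _ => none

def floatUn (f : F64 → F64) : Val → Option Val
  | float x => some (float (f x))
  | _ => none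

def floatBin (f : F64 → F64 → F64) : Val → Val → Option Val
  | float x, float y => some (float (f x y))
  | _, _ => none

def add : Val → Val → Option Val
  | int n, int m => some (int (n + m))
  | ptr b δ, int m => some (ptr b (δ + m))
  | int n, ptr b δ => some (ptr b (δ + n))
  | _, _ => none

def sub : Val → Val → Option Val
  | int n, int m => some (int (n - m))
  | ptr b δ, int m => some (ptr b (δ - m))
  | ptr b δ, ptr b' δ' => if b = b' then some (int (δ - δ')) else none
  | _, _ => none

/-- Boolean negation; pointers and nonzero integers are true, zero is false. -/
def notbool : Val → Option Val
  | int n => some (int (I32.ofBool (decide (n = 0#32))))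
  | ptr _ _ => some (int 0#32)
  | _ => none

def intoffloat : Val → Option Val
  | float x => x.toI32.map int
  | _ => none

def intuoffloat : Val → Option Val
  | float x => x.toU32.map int
  | _ => none

def floatofint : Val → Option Val
  | int n => some (float (F64.ofI32 n))
  | _ => none

def floatofintu : Val → Option Val
  | int n => some (float (F64.ofU32 n))
  | _ => none

/-- Comparison of two values that are known to differ: only tests for (in)equality are defined. -/
def cmpMismatch : Comparison → Option Bool
  | .eq => some false
  | .ne => some true
  | _ => none

/-- Signed integer comparison, and pointer comparison. -/
def cmp (c : Comparison) : Val → Val → Option Bool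
  | int n, int m => some (c.evalS n m)
  | ptr b δ, ptr b' δ' => if b = b' then some (c.evalS δ δ') else cmpMismatch c
  | ptr _ _, int m => if m = 0#32 then cmpMismatch c else none
  | int n, ptr _ _ => if n = 0#32 then cmpMismatch c else none
  | _, _ => none

/-- Unsigned integer comparison. -/
def cmpu (c : Comparison) : Val → Val → Option Bool
  | int n, int m => some (c.evalU n m)
  | _, _ => none

/-- Float comparison. -/
def cmpf (c : Comparison) : Val → Val → Option Bool
  | float x, float y => some (F64.cmp c x y)
  | _, _ => none

end Val

def evalCond : Condition → List Val → Option Bool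
  | .comp c, [v, w] => v.cmp c w
  | .compimm c n, [v] => v.cmp c (.int n)
  | .compu c, [v, w] => v.cmpu c w
  | .compuimm c n, [v] => v.cmpu c (.int n)
  | .compf c, [v, w] => v.cmpf c w
  | _, _ => none

def evalOp {F : Type} (G : GlobalEnv F) (σ : Block) : Operation → List Val → Option Val
  | .move, [v] => some v
  | .intconst n, [] => some (.int n)
  | .floatconst f, [] => some (.float f)
  | .addrsymbol id δ, [] => (G.symbol id).map fun b => .ptr b δ
  | .addrstack δ, [] => some (.ptr σ δ)
  | .cast8s, [v] => v.intUn (I32.signExt 8)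
  | .cast8u, [v] => v.intUn (I32.zeroExt 8)
  | .cast16s, [v] => v.intUn (I32.signExt 16)
  | .cast16u, [v] => v.intUn (I32.zeroExt 16)
  | .negint, [v] => v.intUn (fun x => -x)
  | .notbool, [v] => v.notbool
  | .add, [v, w] => v.add w
  | .addi n, [v] => v.add (.int n)
  | .sub, [v, w] => v.sub w
  | .subi n, [v] => v.intUn (fun x => n - x)
  | .mul, [v, w] => v.intBin (· * ·) w
  | .muli n, [v] => v.intUn (· * n)
  | .div, [v, w] => v.intBin? I32.div w
  | .divu, [v, w] => v.intBin? I32.divu w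
  | .and, [v, w] => v.intBin (· &&& ·) w
  | .andi n, [v] => v.intUn (· &&& n)
  | .or, [v, w] => v.intBin (· ||| ·) w
  | .ori n, [v] => v.intUn (· ||| n)
  | .xor, [v, w] => v.intBin (· ^^^ ·) w
  | .xori n, [v] => v.intUn (· ^^^ n)
  | .nand, [v, w] => v.intBin (fun x y => ~~~(x &&& y)) w
  | .nor, [v, w] => v.intBin (fun x y => ~~~(x ||| y)) w
  | .nxor, [v, w] => v.intBin (fun x y => ~~~(x ^^^ y)) w
  | .shl, [v, w] => v.intBin? I32.shl w
  | .shr, [v, w] => v.intBin? I32.shr w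
  | .shri n, [v] => v.intUn? (fun x => I32.shr x n)
  | .shrxi n, [v] => v.intUn? (fun x => I32.shrx x n)
  | .shru, [v, w] => v.intBin? I32.shru w
  | .rolm a m, [v] => v.intUn (fun x => I32.rolm x a m)
  | .negf, [v] => v.floatUn F64.neg
  | .absf, [v] => v.floatUn F64.abs
  | .addf, [v, w] => v.floatBin F64.add w
  | .subf, [v, w] => v.floatBin F64.sub w
  | .mulf, [v, w] => v.floatBin F64.mul w
  | .divf, [v, w] => v.floatBin F64.div w
  | .singleoffloat, [v] => v.floatUn F64.toSingle
  | .intoffloat, [v] => v.intoffloat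
  | .intuoffloat, [v] => v.intuoffloat
  | .floatofint, [v] => v.floatofint
  | .floatofintu, [v] => v.floatofintu
  | .cmp c, vs => (evalCond c vs).map fun b => .int (I32.ofBool b)
  | _, _ => none

def evalMode {F : Type} (G : GlobalEnv F) (σ : Block) : Mode → List Val → Option Val
  | .indexed n, [.ptr b δ] => some (.ptr b (δ + n))
  | .indexed2, [.ptr b δ, .int n] => some (.ptr b (δ + n))
  | .indexed2, [.int n, .ptr b δ] => some (.ptr b (δ + n))
  | .global id δ, [] => (G.symbol id).map fun b => .ptr b δ
  | .based id δ, [.int n] => (G.symbol id).map fun b => .ptr b (δ + n)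
  | .stack δ, [] => some (.ptr σ δ)
  | _, _ => none

/-! ## RTL -/

namespace RTL

inductive Instruction
  | nop (l : Node)
  | op (op : Operation) (args : List Reg) (res : Reg) (l : Node)
  | load (κ : Chunk) (mode : Mode) (args : List Reg) (dst : Reg) (l : Node)
  | store (κ : Chunk) (mode : Mode) (args : List Reg) (src : Reg) (l : Node)
  | call (sig : Signature) (fn : Reg ⊕ Ident) (args : List Reg) (res : Reg) (l : Node)
  | tailcall (sig : Signature) (fn : Reg ⊕ Ident) (args : List Reg)
  | cond (c : Condition) (args : List Reg) (ltrue lfalse : Node)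
  | ret (arg : Option Reg)

/-- Control-flow graphs: finite maps from labels to instructions. -/
structure CFG where
  get : Node → Option Instruction
  finite_dom : {l | get l ≠ none}.Finite

/-- Instruction-wise transformation of a control-flow graph. -/
def CFG.map (f : Node → Instruction → Instruction) (g : CFG) : CFG where
  get l := (g.get l).map (f l)
  finite_dom := g.finite_dom.subset fun l hl h => hl (by simp [h])

/-- The labels of the nodes of a control-flow graph. -/
noncomputable def CFG.nodes (g : CFG) : List Node := g.finite_dom.toFinset.toList

structure Function where
  sig : Signature
  params : List Reg
  stacksize : ℕ
  entrypoint : Node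
  code : CFG

def _root_.CompCert.FunDef.sig : FunDef Function → Signature
  | .internal f => f.sig
  | .external fe => fe.sig

abbrev Regs := Reg → Val

structure Frame where
  res : Reg
  code : CFG
  sp : Block
  pc : Node
  regs : Regs

inductive State
  | regular (stk : List Frame) (g : CFG) (σ : Block) (l : Node) (R : Regs) (M : Mem)
  | call (stk : List Frame) (fd : FunDef Function) (args : List Val) (M : Mem)
  | ret (stk : List Frame) (v : Val) (M : Mem)

/-- Initial register state of a function: parameters get the arguments, other registers are
undefined. -/
def initRegs : List Reg → List Val → Regs
  | r :: rs, v :: vs => Function.update (initRegs rs vs) r v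
  | _, _ => fun _ => .undef

/-- Resolution of the function designated by a register or by a global name. -/
def findFunction (G : GlobalEnv Function) (R : Regs) : Reg ⊕ Ident → Option (FunDef Function)
  | .inl r =>
    match R r with
    | .ptr b δ => if δ = 0#32 then G.funct b else none
    | _ => none
  | .inr id => (G.symbol id).bind G.funct

inductive Step (G : GlobalEnv Function) : State → Trace → State → Prop
  | nop {stk g σ l R M l'} :
      g.get l = some (.nop l') →
      Step G (.regular stk g σ l R M) [] (.regular stk g σ l' R M)
  | op {stk g σ l R M op args r l' v} :
      g.get l = some (.op op args r l') →
      evalOp G σ op (args.map R) = some v →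
      Step G (.regular stk g σ l R M) [] (.regular stk g σ l' (Function.update R r v) M)
  | load {stk g σ l R M κ mode args r l' b δ v} :
      g.get l = some (.load κ mode args r l') →
      evalMode G σ mode (args.map R) = some (.ptr b δ) →
      M.load κ b δ.toInt = some v →
      Step G (.regular stk g σ l R M) [] (.regular stk g σ l' (Function.update R r v) M)
  | store {stk g σ l R M κ mode args r l' b δ M'} :
      g.get l = some (.store κ mode args r l') →
      evalMode G σ mode (args.map R) = some (.ptr b δ) →
      M.store κ b δ.toInt (R r) = some M' →
      Step G (.regular stk g σ l R M) [] (.regular stk g σ l' R M')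
  | call {stk g σ l R M sig fn args r l' fd} :
      g.get l = some (.call sig fn args r l') →
      findFunction G R fn = some fd →
      fd.sig = sig →
      Step G (.regular stk g σ l R M) [] (.call (⟨r, g, σ, l', R⟩ :: stk) fd (args.map R) M)
  | tailcall {stk g σ l R M sig fn args fd} :
      g.get l = some (.tailcall sig fn args) →
      findFunction G R fn = some fd →
      fd.sig = sig →
      Step G (.regular stk g σ l R M) [] (.call stk fd (args.map R) (M.free σ))
  | condTrue {stk g σ l R M c args ltrue lfalse} :
      g.get l = some (.cond c args ltrue lfalse) →
      evalCond c (args.map R) = some true →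
      Step G (.regular stk g σ l R M) [] (.regular stk g σ ltrue R M)
  | condFalse {stk g σ l R M c args ltrue lfalse} :
      g.get l = some (.cond c args ltrue lfalse) →
      evalCond c (args.map R) = some false →
      Step G (.regular stk g σ l R M) [] (.regular stk g σ lfalse R M)
  | retNone {stk g σ l R M} :
      g.get l = some (.ret none) →
      Step G (.regular stk g σ l R M) [] (.ret stk .undef (M.free σ))
  | retSome {stk g σ l R M r} :
      g.get l = some (.ret (some r)) →
      Step G (.regular stk g σ l R M) [] (.ret stk (R r) (M.free σ))
  | internal {stk f args M σ M'} :
      M.alloc 0 (f.stacksize : ℤ) = (σ, M') →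
      Step G (.call stk (.internal f) args M) []
        (.regular stk f.code σ f.entrypoint (initRegs f.params args) M')
  | external {stk fe args M t v} :
      ExtCall fe args t v →
      Step G (.call stk (.external fe) args M) t (.ret stk v M)
  | ret {r g σ l R stk v M} :
      Step G (.ret (⟨r, g, σ, l, R⟩ :: stk) v M) []
        (.regular stk g σ l (Function.update R r v) M)

inductive Initial (P : Program Function) : State → Prop
  | intro {b fd} :
      (globalenv P).symbol P.main = some b →
      (globalenv P).funct b = some fd →
      Initial P (.call [] fd [] (initmem P))

inductive Final : State → I32 → Prop
  | intro {n M} : Final (.ret [] (.int n) M) n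

/-- The transition semantics of an RTL program. -/
def sem (P : Program Function) : TransSem where
  State := State
  step := Step (globalenv P)
  initial := Initial P
  final := Final

end RTL

/-! ## Kildall's worklist algorithm -/

namespace Kildall

variable {α : Type} [SemilatticeSup α] [OrderBot α] [DecidableEq α]

/-- Merge the value `out` into the current value at `s`; if this changes it, `s` has to be
processed again. -/
def propagate (out : α) (st : (Node → α) × List Node) (s : Node) : (Node → α) × List Node :=
  if st.1 s ⊔ out = st.1 s then st
  else (Function.update st.1 s (st.1 s ⊔ out), s :: st.2)

/-- Run the worklist algorithm for at most `n` iterations. -/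
def iterate (succs : Node → List Node) (T : Node → α → α) :
    ℕ → (Node → α) × List Node → Option (Node → α)
  | _, (A, []) => some A
  | 0, (_, _ :: _) => none
  | n + 1, (A, l :: W) =>
    iterate succs T n ((succs l).foldl (propagate (T l (A l))) (A, W))

/-- Starting point: the least assignment satisfying the constraints. -/
def start (cstrs : List (Node × α)) : Node → α :=
  cstrs.foldl (fun A c => Function.update A c.1 (A c.1 ⊔ c.2)) (fun _ => ⊥)

/-- Solver for the forward dataflow inequations `T l (A l) ≤ A s` for `s ∈ succs l`, and `a ≤ A l`
for `(l, a) ∈ cstrs`. Initially the worklist contains all nodes; failure after `N` iterations. -/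
def solve (N : ℕ) (nodes : List Node) (succs : Node → List Node) (T : Node → α → α)
    (cstrs : List (Node × α)) : Option (Node → α) :=
  iterate succs T N (start cstrs, nodes)

end Kildall

/-! ## Constant propagation -/

/-- Abstract values: unreachable, unknown, or a known integer, float or symbol address. -/
inductive AVal
  | bot
  | top
  | int (n : I32)
  | float (f : F64)
  | addrsymbol (id : Ident) (δ : I32)
deriving DecidableEq

namespace AVal

/-- The flat order. -/
instance : PartialOrder AVal where
  le a b := a = bot ∨ b = top ∨ a = b
  le_refl _ := .inr (.inr rfl)
  le_trans a b c := by
    rintro (rfl | rfl | rfl) (h | rfl | rfl) <;> simp_all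
  le_antisymm a b := by
    rintro (rfl | rfl | rfl) (h | h | h) <;> simp_all

/-- The flat join. -/
def join (a b : AVal) : AVal :=
  if a = bot then b else if b = bot then a else if a = b then a else top

instance : SemilatticeSup AVal where
  sup := join
  le_sup_left a b := by
    change _ ∨ _ ∨ _
    unfold join; split_ifs <;> simp_all
  le_sup_right a b := by
    change _ ∨ _ ∨ _
    unfold join; split_ifs <;> simp_all
  sup_le a b c := by
    change (_ ∨ _ ∨ _) → (_ ∨ _ ∨ _) → (_ ∨ _ ∨ _)
    unfold join; split_ifs <;> rintro (h | h | h) (h' | h' | h') <;> simp_all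

instance : OrderBot AVal where
  bot := bot
  bot_le _ := .inl rfl

instance : OrderTop AVal where
  top := top
  le_top _ := .inr (.inl rfl)

def intUn (f : I32 → I32) : AVal → AVal
  | int n => int (f n)
  | _ => top

def ofInt? : Option I32 → AVal
  | some n => int n
  | none => top

def intUn? (f : I32 → Option I32) : AVal → AVal
  | int n => ofInt? (f n)
  | _ => top

def intBin (f : I32 → I32 → I32) : AVal → AVal → AVal
  | int n, int m => int (f n m)
  | _, _ => top

def intBin? (f : I32 → I32 → Option I32) : AVal → AVal → AVal
  | int n, int m => ofInt? (f n m)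
  | _, _ => top

def floatUn (f : F64 → F64) : AVal → AVal
  | float x => float (f x)
  | _ => top

def floatBin (f : F64 → F64 → F64) : AVal → AVal → AVal
  | float x, float y => float (f x y)
  | _, _ => top

def add : AVal → AVal → AVal
  | int n, int m => int (n + m)
  | addrsymbol id δ, int m => addrsymbol id (δ + m)
  | int n, addrsymbol id δ => addrsymbol id (δ + n)
  | _, _ => top

def sub : AVal → AVal → AVal
  | int n, int m => int (n - m)
  | addrsymbol id δ, int m => addrsymbol id (δ - m)
  | _, _ => top

def notbool : AVal → AVal
  | int n => int (I32.ofBool (decide (n = 0#32)))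
  | addrsymbol _ _ => int 0#32
  | _ => top

def intoffloat : AVal → AVal
  | float x => ofInt? x.toI32
  | _ => top

def intuoffloat : AVal → AVal
  | float x => ofInt? x.toU32
  | _ => top

def floatofint : AVal → AVal
  | int n => float (F64.ofI32 n)
  | _ => top

def floatofintu : AVal → AVal
  | int n => float (F64.ofU32 n)
  | _ => top

end AVal

/-- Static evaluation of conditions; `none` when the outcome is unknown. -/
def evalCondStatic : Condition → List AVal → Option Bool
  | .comp c, [.int n, .int m] => some (c.evalS n m)
  | .compimm c m, [.int n] => some (c.evalS n m)
  | .compu c, [.int n, .int m] => some (c.evalU n m)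
  | .compuimm c m, [.int n] => some (c.evalU n m)
  | .compf c, [.float x, .float y] => some (F64.cmp c x y)
  | _, _ => none

/-- Abstract interpretation of `evalOp`. -/
def evalOpStatic : Operation → List AVal → AVal
  | .move, [a] => a
  | .intconst n, [] => .int n
  | .floatconst f, [] => .float f
  | .addrsymbol id δ, [] => .addrsymbol id δ
  | .cast8s, [a] => a.intUn (I32.signExt 8)
  | .cast8u, [a] => a.intUn (I32.zeroExt 8)
  | .cast16s, [a] => a.intUn (I32.signExt 16)
  | .cast16u, [a] => a.intUn (I32.zeroExt 16)
  | .negint, [a] => a.intUn (fun x => -x)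
  | .notbool, [a] => a.notbool
  | .add, [a, b] => a.add b
  | .addi n, [a] => a.add (.int n)
  | .sub, [a, b] => a.sub b
  | .subi n, [a] => a.intUn (fun x => n - x)
  | .mul, [a, b] => a.intBin (· * ·) b
  | .muli n, [a] => a.intUn (· * n)
  | .div, [a, b] => a.intBin? I32.div b
  | .divu, [a, b] => a.intBin? I32.divu b
  | .and, [a, b] => a.intBin (· &&& ·) b
  | .andi n, [a] => a.intUn (· &&& n)
  | .or, [a, b] => a.intBin (· ||| ·) b
  | .ori n, [a] => a.intUn (· ||| n)
  | .xor, [a, b] => a.intBin (· ^^^ ·) b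
  | .xori n, [a] => a.intUn (· ^^^ n)
  | .nand, [a, b] => a.intBin (fun x y => ~~~(x &&& y)) b
  | .nor, [a, b] => a.intBin (fun x y => ~~~(x ||| y)) b
  | .nxor, [a, b] => a.intBin (fun x y => ~~~(x ^^^ y)) b
  | .shl, [a, b] => a.intBin? I32.shl b
  | .shr, [a, b] => a.intBin? I32.shr b
  | .shri n, [a] => a.intUn? (fun x => I32.shr x n)
  | .shrxi n, [a] => a.intUn? (fun x => I32.shrx x n)
  | .shru, [a, b] => a.intBin? I32.shru b
  | .rolm k m, [a] => a.intUn (fun x => I32.rolm x k m)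
  | .negf, [a] => a.floatUn F64.neg
  | .absf, [a] => a.floatUn F64.abs
  | .addf, [a, b] => a.floatBin F64.add b
  | .subf, [a, b] => a.floatBin F64.sub b
  | .mulf, [a, b] => a.floatBin F64.mul b
  | .divf, [a, b] => a.floatBin F64.div b
  | .singleoffloat, [a] => a.floatUn F64.toSingle
  | .intoffloat, [a] => a.intoffloat
  | .intuoffloat, [a] => a.intuoffloat
  | .floatofint, [a] => a.floatofint
  | .floatofintu, [a] => a.floatofintu
  | .cmp c, as =>
    match evalCondStatic c as with
    | some b => .int (I32.ofBool b)
    | none => .top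
  | _, _ => .top

namespace Constprop

open RTL

/-- Abstract register states. -/
abbrev ARegs := Reg → AVal

/-! ### Static analysis -/

def successors : Instruction → List Node
  | .nop l => [l]
  | .op _ _ _ l => [l]
  | .load _ _ _ _ l => [l]
  | .store _ _ _ _ l => [l]
  | .call _ _ _ _ l => [l]
  | .tailcall _ _ _ => []
  | .cond _ _ ltrue lfalse => [ltrue, lfalse]
  | .ret _ => []

/-- Transfer function. -/
def transfer (f : Function) (l : Node) (a : ARegs) : ARegs :=
  match f.code.get l with
  | some (.op op args r _) => Function.update a r (evalOpStatic op (args.map a))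
  | some (.load _ _ _ r _) => Function.update a r ⊤
  | some (.call _ _ _ r _) => Function.update a r ⊤
  | _ => a

/-- The solution found by Kildall's algorithm within `N` iterations, or the trivial one. -/
noncomputable def analyze (N : ℕ) (f : Function) : Node → ARegs :=
  open Classical in
  (Kildall.solve N f.code.nodes (fun l => ((f.code.get l).map successors).getD [])
    (transfer f) [(f.entrypoint, ⊤)]).getD (fun _ => ⊤)

/-! ### Specialization of operators, conditions and addressing modes -/

def addImm (n : I32) (r : Reg) : Operation × List Reg :=
  if n = 0#32 then (.move, [r]) else (.addi n, [r])

def shlImm (n : I32) (r : Reg) : Operation × List Reg :=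
  if n = 0#32 then (.move, [r]) else (.rolm n (BitVec.allOnes 32 <<< n.toNat), [r])

def shrImm (n : I32) (r : Reg) : Operation × List Reg :=
  if n = 0#32 then (.move, [r]) else (.shri n, [r])

def shruImm (n : I32) (r : Reg) : Operation × List Reg :=
  if n = 0#32 then (.move, [r])
  else (.rolm (32#32 - n) (BitVec.allOnes 32 >>> n.toNat), [r])

def mulImm (n : I32) (r : Reg) : Operation × List Reg :=
  if n = 0#32 then (.intconst 0#32, [])
  else if n = 1#32 then (.move, [r])
  else match I32.log2? n with
    | some k => shlImm k r
    | none => (.muli n, [r])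

def andImm (n : I32) (r : Reg) : Operation × List Reg :=
  if n = 0#32 then (.intconst 0#32, [])
  else if n = BitVec.allOnes 32 then (.move, [r])
  else (.andi n, [r])

def orImm (n : I32) (r : Reg) : Operation × List Reg :=
  if n = 0#32 then (.move, [r])
  else if n = BitVec.allOnes 32 then (.intconst (BitVec.allOnes 32), [])
  else (.ori n, [r])

def xorImm (n : I32) (r : Reg) : Operation × List Reg :=
  if n = 0#32 then (.move, [r]) else (.xori n, [r])

def specCond (a : ARegs) (c : Condition) (args : List Reg) : Condition × List Reg :=
  match c, args with
  | .comp c, [r₁, r₂] =>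
    match a r₁, a r₂ with
    | .int n, _ => (.compimm c.swap n, [r₂])
    | _, .int m => (.compimm c m, [r₁])
    | _, _ => (.comp c, [r₁, r₂])
  | .compu c, [r₁, r₂] =>
    match a r₁, a r₂ with
    | .int n, _ => (.compuimm c.swap n, [r₂])
    | _, .int m => (.compuimm c m, [r₁])
    | _, _ => (.compu c, [r₁, r₂])
  | c, args => (c, args)

def specOp (a : ARegs) (op : Operation) (args : List Reg) : Operation × List Reg :=
  match op, args with
  | .add, [r₁, r₂] =>
    match a r₁, a r₂ with
    | .int n, _ => addImm n r₂
    | _, .int m => addImm m r₁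
    | _, _ => (op, args)
  | .sub, [r₁, r₂] =>
    match a r₁, a r₂ with
    | .int n, _ => (.subi n, [r₂])
    | _, .int m => addImm (-m) r₁
    | _, _ => (op, args)
  | .mul, [r₁, r₂] =>
    match a r₁, a r₂ with
    | .int n, _ => mulImm n r₂
    | _, .int m => mulImm m r₁
    | _, _ => (op, args)
  | .div, [r₁, r₂] =>
    match a r₂ with
    | .int m =>
      match I32.log2? m with
      | some k => if k.toNat < 31 then (.shrxi k, [r₁]) else (op, args)
      | none => (op, args)
    | _ => (op, args)
  | .divu, [r₁, r₂] =>
    match a r₂ with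
    | .int m =>
      match I32.log2? m with
      | some k => shruImm k r₁
      | none => (op, args)
    | _ => (op, args)
  | .and, [r₁, r₂] =>
    match a r₁, a r₂ with
    | .int n, _ => andImm n r₂
    | _, .int m => andImm m r₁
    | _, _ => (op, args)
  | .or, [r₁, r₂] =>
    match a r₁, a r₂ with
    | .int n, _ => orImm n r₂
    | _, .int m => orImm m r₁
    | _, _ => (op, args)
  | .xor, [r₁, r₂] =>
    match a r₁, a r₂ with
    | .int n, _ => xorImm n r₂
    | _, .int m => xorImm m r₁
    | _, _ => (op, args)
  | .shl, [r₁, r₂] =>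
    match a r₂ with
    | .int m => if m.toNat < 32 then shlImm m r₁ else (op, args)
    | _ => (op, args)
  | .shr, [r₁, r₂] =>
    match a r₂ with
    | .int m => if m.toNat < 32 then shrImm m r₁ else (op, args)
    | _ => (op, args)
  | .shru, [r₁, r₂] =>
    match a r₂ with
    | .int m => if m.toNat < 32 then shruImm m r₁ else (op, args)
    | _ => (op, args)
  | .cmp c, args => (.cmp (specCond a c args).1, (specCond a c args).2)
  | op, args => (op, args)

def specMode (a : ARegs) (mode : Mode) (args : List Reg) : Mode × List Reg :=
  match mode, args with
  | .indexed n, [r] =>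
    match a r with
    | .addrsymbol id δ => (.global id (δ + n), [])
    | _ => (mode, args)
  | .indexed2, [r₁, r₂] =>
    match a r₁, a r₂ with
    | .addrsymbol id δ, .int m => (.global id (δ + m), [])
    | .int n, .addrsymbol id δ => (.global id (δ + n), [])
    | .addrsymbol id δ, _ => (.based id δ, [r₂])
    | _, .addrsymbol id δ => (.based id δ, [r₁])
    | .int n, _ => (.indexed n, [r₂])
    | _, .int m => (.indexed m, [r₁])
    | _, _ => (mode, args)
  | .based id δ, [r] =>
    match a r with
    | .int n => (.global id (δ + n), [])
    | _ => (mode, args)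
  | mode, args => (mode, args)

/-! ### Code transformation -/

/-- Transformation of an instruction, given the abstract values at its program point. -/
def transfInstr (a : ARegs) : Instruction → Instruction
  | .op op args r l =>
    match evalOpStatic op (args.map a) with
    | .int n => .op (.intconst n) [] r l
    | .float f => .op (.floatconst f) [] r l
    | .addrsymbol id δ => .op (.addrsymbol id δ) [] r l
    | _ => .op (specOp a op args).1 (specOp a op args).2 r l
  | .load κ mode args r l => .load κ (specMode a mode args).1 (specMode a mode args).2 r l
  | .store κ mode args r l => .store κ (specMode a mode args).1 (specMode a mode args).2 r l
  | .cond c args ltrue lfalse =>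
    match evalCondStatic c (args.map a) with
    | some true => .nop ltrue
    | some false => .nop lfalse
    | none => .cond (specCond a c args).1 (specCond a c args).2 ltrue lfalse
  | i => i

/-- Constant propagation for a function; `N` bounds the iterations of the static analysis. -/
noncomputable def transf (N : ℕ) (f : Function) : Except String Function :=
  .ok { f with code := f.code.map fun l => transfInstr (analyze N f l) }

/-! ### The simulation relation -/

/-- Agreement between a concrete and an abstract value. -/
inductive Agree (G : GlobalEnv Function) : Val → AVal → Prop
  | top (v : Val) : Agree G v .top
  | int (n : I32) : Agree G (.int n) (.int n)
  | float (f : F64) : Agree G (.float f) (.float f)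
  | addrsymbol {id : Ident} {δ : I32} {b : Block} :
      G.symbol id = some b → Agree G (.ptr b δ) (.addrsymbol id δ)

/-- Agreement between concrete and abstract register states. -/
def RegsAgree (G : GlobalEnv Function) (R : Regs) (a : ARegs) : Prop := ∀ r, Agree G (R r) (a r)

/-- Matching call stacks. The value `v` that will be returned to the pending call is arbitrary. -/
inductive MatchStacks (N : ℕ) (G : GlobalEnv Function) : List Frame → List Frame → Prop
  | nil : MatchStacks N G [] []
  | cons {f f' : Function} {stk stk' : List Frame} {r : Reg} {σ : Block} {l : Node} {R : Regs} :
      transf N f = .ok f' →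
      MatchStacks N G stk stk' →
      (∀ v, RegsAgree G (Function.update R r v) (analyze N f l)) →
      MatchStacks N G (⟨r, f.code, σ, l, R⟩ :: stk) (⟨r, f'.code, σ, l, R⟩ :: stk')

/-- Matching states. -/
inductive MatchStates (N : ℕ) (G : GlobalEnv Function) : State → State → Prop
  | regular {f f' : Function} {stk stk' : List Frame} {σ : Block} {l : Node} {R : Regs} {M : Mem} :
      transf N f = .ok f' →
      MatchStacks N G stk stk' →
      RegsAgree G R (analyze N f l) →
      MatchStates N G (.regular stk f.code σ l R M) (.regular stk' f'.code σ l R M)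
  | call {fd fd' : FunDef Function} {stk stk' : List Frame} {args : List Val} {M : Mem} :
      transfFunDef (transf N) fd = .ok fd' →
      MatchStacks N G stk stk' →
      MatchStates N G (.call stk fd args M) (.call stk' fd' args M)
  | ret {stk stk' : List Frame} {v : Val} {M : Mem} :
      MatchStacks N G stk stk' →
      MatchStates N G (.ret stk v M) (.ret stk' v M)

end Constprop

end CompCert

/-! Both programs run in lock step on the same registers, stack blocks and memory. The invariant is
that the current registers agree with the result of the analysis at the current node. Three facts
carry the proof.

The analysis is sound. Whatever the iteration bound, its result satisfies the dataflow inequations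
and is `⊤` at the entry point (`analyze_spec`): either Kildall's algorithm returned a solution, or
the result is constantly `⊤`. The transfer function over-approximates the effect of an instruction
on the registers (`agree_evalOpStatic`), and agreement survives going up in the order
(`Agree.mono`), so it passes from a node to each successor.

The rewriting is faithful under agreement. A statically known result or outcome is the actual one,
and a specialized operator, condition or addressing mode has the same value whenever the original is
defined (`evalOp_specOp`, `evalCond_specCond`, `evalMode_specMode`). The converse fails:
multiplication by a known zero becomes the constant zero even for a non-integer operand. The new
program may therefore run where the old one is stuck, which is why going-wrong behaviors are
excluded.

The rewriting of programs keeps names, positions and variables, so symbols denote the same blocks,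
function pointers lead to corresponding functions, and the initial memories are equal.

Together these give `step_simulation`. Induction on finite executions and coinduction on infinite
ones then transfer the behaviors (`Behaves.simulation`). -/

namespace CompCert

/-! ## Arithmetic identities behind operator specialization -/

namespace I32

/-- Rotation and shift differ only in the `n` low bits, which the mask clears. -/
theorem rolm_shl (x n : I32) (hn : n.toNat < 32) :
    rolm x n (BitVec.allOnes 32 <<< n.toNat) = x <<< n.toNat := by
  unfold rolm
  ext i hi
  simp only [BitVec.getElem_and, BitVec.getElem_rotateLeft, BitVec.getElem_shiftLeft,
    BitVec.getElem_allOnes, Nat.mod_eq_of_lt hn]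
  by_cases h : i < n.toNat <;> simp [h]

/-- Rotating left by `32 - n` is rotating right by `n`; the mask clears the `n` high bits, where the
wrapped bits land. With `n ≠ 0` the amount stays below 32, so its reduction modulo 32 does nothing.
-/
theorem rolm_shru (x n : I32) (hn : n.toNat < 32) (h0 : n ≠ 0#32) :
    rolm x (32#32 - n) (BitVec.allOnes 32 >>> n.toNat) = x >>> n.toNat := by
  have hpos : 0 < n.toNat :=
    Nat.pos_of_ne_zero fun h => h0 (BitVec.eq_of_toNat_eq (by simpa using h))
  have hs : (32#32 - n).toNat = 32 - n.toNat := by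
    rw [BitVec.toNat_sub]; simp; omega
  unfold rolm
  ext i hi
  simp only [BitVec.getElem_and, BitVec.getElem_rotateLeft, hs,
    Nat.mod_eq_of_lt (by omega : 32 - n.toNat < 32), BitVec.getElem_ushiftRight,
    BitVec.getLsbD_allOnes]
  by_cases h : n.toNat + i < 32
  · have : i < 32 - n.toNat := by omega
    have e : 32 - (32 - n.toNat) + i = n.toNat + i := by omega
    simp [h, this, e]
  · rw [BitVec.getLsbD_of_ge _ _ (by omega)]
    simp [h]

/-- Since `n < 2 ^ 32`, the logarithm is below 32: encoding it as a word loses nothing, and it is a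
legal shift amount. -/
theorem toNat_of_log2? {n k : I32} (h : log2? n = some k) : k.toNat < 32 ∧ n.toNat = 2 ^ k.toNat := by
  unfold log2? at h
  split_ifs at h with hn
  simp only [Option.some.injEq] at h
  have hlt : Nat.log 2 n.toNat < 32 := by
    refine (Nat.pow_lt_pow_iff_right (a := 2) (by norm_num)).1 ?_
    rw [← hn]; exact n.isLt
  have hk : k.toNat = Nat.log 2 n.toNat := by
    rw [← h, BitVec.toNat_ofNat]; exact Nat.mod_eq_of_lt (by omega)
  rw [hk]; exact ⟨hlt, hn⟩

theorem eq_shl_of_log2? {n k : I32} (h : log2? n = some k) : n = 1#32 <<< k.toNat := by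
  obtain ⟨hk, hn⟩ := toNat_of_log2? h
  apply BitVec.eq_of_toNat_eq
  rw [hn, BitVec.toNat_shiftLeft, Nat.shiftLeft_eq]
  have : 2 ^ k.toNat < 2 ^ 32 := Nat.pow_lt_pow_right (by norm_num) hk
  rw [show (1#32).toNat = 1 from rfl, one_mul, Nat.mod_eq_of_lt this]

theorem mul_of_log2? {n k : I32} (h : log2? n = some k) (x : I32) : x * n = x <<< k.toNat := by
  obtain ⟨hk, hn⟩ := toNat_of_log2? h
  apply BitVec.eq_of_toNat_eq
  rw [BitVec.toNat_mul, hn, BitVec.toNat_shiftLeft, Nat.shiftLeft_eq]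

theorem udiv_of_log2? {n k : I32} (h : log2? n = some k) (x : I32) :
    x.udiv n = x >>> k.toNat := by
  obtain ⟨hk, hn⟩ := toNat_of_log2? h
  apply BitVec.eq_of_toNat_eq
  change (x / n).toNat = _
  rw [BitVec.toNat_udiv, hn, BitVec.toNat_ushiftRight, Nat.shiftRight_eq_div_pow]

end I32

theorem Comparison.evalS_swap (c : Comparison) (x y : I32) : c.swap.evalS y x = c.evalS x y := by
  cases c <;> simp [Comparison.swap, Comparison.evalS, eq_comm]

theorem Comparison.evalU_swap (c : Comparison) (x y : I32) : c.swap.evalU y x = c.evalU x y := by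
  cases c <;> simp [Comparison.swap, Comparison.evalU, eq_comm]

/-! ### Exchange of operands, and operations with one constant operand. -/

namespace Val

theorem cmpMismatch_swap (c : Comparison) : cmpMismatch c.swap = cmpMismatch c := by
  cases c <;> rfl

/-- Immediate comparisons take their constant on the right, so a constant left operand has to be
moved there. Pointers compared with zero are covered because `cmpMismatch` is invariant under
`swap`. -/
theorem cmp_swap (c : Comparison) (n : I32) (v : Val) : v.cmp c.swap (.int n) = (int n).cmp c v := by
  cases v <;> simp [cmp, Comparison.evalS_swap, cmpMismatch_swap]

theorem cmpu_swap (c : Comparison) (n : I32) (v : Val) :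
    v.cmpu c.swap (.int n) = (int n).cmpu c v := by
  cases v <;> simp [cmpu, Comparison.evalU_swap]

theorem add_int_comm (n : I32) (v : Val) : (int n).add v = v.add (.int n) := by
  cases v <;> simp [add, BitVec.add_comm]

/-- Subtraction of a constant is specialized to an addition, since `subi` subtracts from the
constant. The identity also covers pointer offsets. -/
theorem add_int_neg (n : I32) (v : Val) : v.add (.int (-n)) = v.sub (.int n) := by
  cases v <;> simp [add, sub, BitVec.sub_eq_add_neg]

theorem intBin_comm {f : I32 → I32 → I32} (hf : ∀ x y, f x y = f y x) (v w : Val) :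
    v.intBin f w = w.intBin f v := by
  cases v <;> cases w <;> simp [intBin, hf]

theorem sub_int_left (n : I32) (v : Val) : (int n).sub v = v.intUn (fun x => n - x) := by
  cases v <;> rfl

theorem intBin_int_right (f : I32 → I32 → I32) (n : I32) (v : Val) :
    v.intBin f (.int n) = v.intUn (f · n) := by
  cases v <;> rfl

theorem intBin?_int_right (f : I32 → I32 → Option I32) (n : I32) (v : Val) :
    v.intBin? f (.int n) = v.intUn? (f · n) := by
  cases v <;> rfl

theorem exists_int_of_intUn {f : I32 → I32} {v w : Val} (h : v.intUn f = some w) :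
    ∃ x, v = int x ∧ w = int (f x) := by
  cases v <;> simp_all [intUn]

theorem exists_int_of_intUn? {f : I32 → Option I32} {v w : Val} (h : v.intUn? f = some w) :
    ∃ x y, v = int x ∧ f x = some y ∧ w = int y := by
  cases v with
  | int x =>
    obtain ⟨y, hy, rfl⟩ := Option.map_eq_some_iff.1 h
    exact ⟨x, y, rfl, hy, rfl⟩
  | _ => simp [intUn?] at h

end Val

namespace Kildall

variable {α : Type} [SemilatticeSup α] [DecidableEq α]

/-! ## Correctness of Kildall's algorithm -/

theorem le_propagate (out : α) (st : (Node → α) × List Node) (s l : Node) :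
    st.1 l ≤ (propagate out st s).1 l := by
  unfold propagate
  split_ifs with h
  · exact le_rfl
  · by_cases hl : l = s
    · subst hl; simp
    · simp [hl]

theorem out_le_propagate (out : α) (st : (Node → α) × List Node) (s : Node) :
    out ≤ (propagate out st s).1 s := by
  unfold propagate
  split_ifs with h
  · rw [← h]; exact le_sup_right
  · simp

/-- The purpose of the worklist: a node whose value changes is scheduled again, so the inequations
of unscheduled nodes have an unchanged left side. -/
theorem propagate_eq_or_mem (out : α) (st : (Node → α) × List Node) (s l : Node) :
    (propagate out st s).1 l = st.1 l ∨ l ∈ (propagate out st s).2 := by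
  unfold propagate
  split_ifs with h
  · exact .inl rfl
  · by_cases hl : l = s
    · subst hl; simp
    · simp [hl]

theorem subset_propagate (out : α) (st : (Node → α) × List Node) (s : Node) :
    st.2 ⊆ (propagate out st s).2 := by
  unfold propagate
  split_ifs with h <;> simp

theorem le_foldl_propagate (out : α) (ss : List Node) (st : (Node → α) × List Node) (l : Node) :
    st.1 l ≤ (ss.foldl (propagate out) st).1 l := by
  induction ss generalizing st with
  | nil => exact le_rfl
  | cons s ss ih => exact (le_propagate out st s l).trans (ih _)

theorem out_le_foldl_propagate (out : α) (ss : List Node) (st : (Node → α) × List Node) {s : Node}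
    (hs : s ∈ ss) : out ≤ (ss.foldl (propagate out) st).1 s := by
  induction ss generalizing st with
  | nil => simp at hs
  | cons s' ss ih =>
    rcases List.mem_cons.1 hs with rfl | hs
    · exact (out_le_propagate out st s).trans (le_foldl_propagate out ss _ s)
    · exact ih _ hs

theorem subset_foldl_propagate (out : α) (ss : List Node) (st : (Node → α) × List Node) :
    st.2 ⊆ (ss.foldl (propagate out) st).2 := by
  induction ss generalizing st with
  | nil => exact List.Subset.refl _
  | cons s ss ih => exact fun _ h => ih _ (subset_propagate out st s h)

theorem foldl_propagate_eq_or_mem (out : α) (ss : List Node) (st : (Node → α) × List Node)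
    (l : Node) :
    (ss.foldl (propagate out) st).1 l = st.1 l ∨ l ∈ (ss.foldl (propagate out) st).2 := by
  induction ss generalizing st with
  | nil => exact .inl rfl
  | cons s ss ih =>
    rcases ih (propagate out st s) with h | h
    · rcases propagate_eq_or_mem out st s l with h' | h'
      · exact .inl (h.trans h')
      · exact .inr (subset_foldl_propagate out ss _ h')
    · exact .inr h

/-- The result of `iterate` is above the starting assignment, and satisfies all inequations if the
starting assignment satisfies those of the nodes outside the worklist. -/
theorem iterate_spec {nodes : Set Node} {succs : Node → List Node} {T : Node → α → α} {N : ℕ}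
    {st : (Node → α) × List Node} {A : Node → α} (h : iterate succs T N st = some A)
    (hst : ∀ l ∈ nodes, l ∉ st.2 → ∀ s ∈ succs l, T l (st.1 l) ≤ st.1 s) :
    (∀ l, st.1 l ≤ A l) ∧ ∀ l ∈ nodes, ∀ s ∈ succs l, T l (A l) ≤ A s := by
  induction N generalizing st with
  | zero =>
    obtain ⟨A₀, _ | ⟨l, W⟩⟩ := st
    · simp only [iterate, Option.some.injEq] at h
      subst h
      exact ⟨fun _ => le_rfl, fun l hl => hst l hl (by simp)⟩
    · simp [iterate] at h
  | succ N ih =>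
    obtain ⟨A₀, _ | ⟨l, W⟩⟩ := st
    · simp only [iterate, Option.some.injEq] at h
      subst h
      exact ⟨fun _ => le_rfl, fun l hl => hst l hl (by simp)⟩
    · simp only [iterate] at h
      obtain ⟨h₁, h₂⟩ := ih h (by
        intro m hm hmW s hs
        have hle := le_foldl_propagate (T l (A₀ l)) (succs l) (A₀, W) s
        -- A node outside the new worklist kept its value, even `l` itself when it is its own
        -- successor. For `m = l` the inequation holds because `T l (A₀ l)` was just propagated; for
        -- `m ≠ l` it held before, and its right side can only have grown. Monotonicity of `T` plays
        -- no role.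
        rcases foldl_propagate_eq_or_mem (T l (A₀ l)) (succs l) (A₀, W) m with he | he
        · rw [he]
          by_cases hml : m = l
          · subst hml
            exact out_le_foldl_propagate _ _ _ hs
          · refine (hst m hm ?_ s hs).trans hle
            rintro hmem
            rcases List.mem_cons.1 hmem with h' | h'
            · exact hml h'
            · exact hmW (subset_foldl_propagate _ _ (A₀, W) h')
        · exact absurd he hmW)
      exact ⟨fun m => (le_foldl_propagate _ _ (A₀, W) m).trans (h₁ m), h₂⟩

/-- Initially every node is in the worklist, so the hypothesis of `iterate_spec` is vacuous. -/
theorem solve_spec [OrderBot α] {nodes : List Node} {succs : Node → List Node} {T : Node → α → α} {N : ℕ}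
    {cstrs : List (Node × α)} {A : Node → α} (h : solve N nodes succs T cstrs = some A) :
    (∀ l, start cstrs l ≤ A l) ∧ ∀ l ∈ nodes, ∀ s ∈ succs l, T l (A l) ≤ A s :=
  iterate_spec (nodes := {l | l ∈ nodes}) h fun _ hl hl' => absurd hl hl'

end Kildall

end CompCert

namespace CompCert

namespace Constprop

open RTL

/-! ## Agreement -/

section Agreement

variable {G : GlobalEnv Function}

/-- In the flat order, going up means staying put, reaching `⊤`, or leaving `⊥`; no value agrees
with `⊥`, which marks unreachable points. -/
theorem Agree.mono {v : Val} {a b : AVal} (h : Agree G v a) (hab : a ≤ b) : Agree G v b := by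
  rcases hab with rfl | rfl | rfl
  · cases h
  · exact .top v
  · exact h

theorem RegsAgree.mono {R : Regs} {a b : ARegs} (h : RegsAgree G R a) (hab : a ≤ b) :
    RegsAgree G R b := fun r => (h r).mono (hab r)

theorem RegsAgree.update {R : Regs} {a : ARegs} (h : RegsAgree G R a) {r : Reg} {v : Val} {x : AVal}
    (hv : Agree G v x) : RegsAgree G (Function.update R r v) (Function.update a r x) := by
  intro r'
  by_cases hr : r' = r
  · subst hr; simpa using hv
  · simpa [hr] using h r'

theorem RegsAgree.forall₂ {R : Regs} {a : ARegs} (h : RegsAgree G R a) (args : List Reg) :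
    List.Forall₂ (Agree G) (args.map R) (args.map a) := by
  induction args with
  | nil => exact .nil
  | cons r rs ih => exact .cons (h r) ih

theorem Agree.eq_int {v : Val} {n : I32} (h : Agree G v (.int n)) : v = .int n := by
  cases h; rfl

theorem Agree.eq_float {v : Val} {x : F64} (h : Agree G v (.float x)) : v = .float x := by
  cases h; rfl

theorem Agree.exists_ptr {v : Val} {id : Ident} {δ : I32} (h : Agree G v (.addrsymbol id δ)) :
    ∃ b, v = .ptr b δ ∧ G.symbol id = some b := by
  cases h with | addrsymbol hb => exact ⟨_, rfl, hb⟩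

/-! ## Soundness of the abstract interpretation of operators -/

theorem Agree.ofInt? {o : Option I32} {w : Val} (h : o.map Val.int = some w) :
    Agree G w (AVal.ofInt? o) := by
  obtain ⟨n, rfl, rfl⟩ := Option.map_eq_some_iff.1 h
  exact .int n

/-- The pattern for all operators below: the abstract result is `⊤` unless the abstract arguments
have a known suitable form. In that case agreement determines the shape of the concrete arguments,
and both computations coincide. -/
theorem Agree.intUn {f : I32 → I32} {v w : Val} {a : AVal} (ha : Agree G v a)
    (h : v.intUn f = some w) : Agree G w (a.intUn f) := by
  cases ha <;> simp_all [Val.intUn, AVal.intUn] <;> subst_vars <;> constructor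

theorem Agree.intUn? {f : I32 → Option I32} {v w : Val} {a : AVal} (ha : Agree G v a)
    (h : v.intUn? f = some w) : Agree G w (a.intUn? f) := by
  cases ha
  case int n => exact .ofInt? h
  all_goals exact .top _

theorem Agree.intBin {f : I32 → I32 → I32} {v v' w : Val} {a a' : AVal} (ha : Agree G v a)
    (ha' : Agree G v' a') (h : v.intBin f v' = some w) : Agree G w (a.intBin f a') := by
  cases ha <;> cases ha' <;> simp_all [Val.intBin, AVal.intBin] <;> subst_vars <;> constructor

theorem Agree.intBin? {f : I32 → I32 → Option I32} {v v' w : Val} {a a' : AVal}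
    (ha : Agree G v a) (ha' : Agree G v' a') (h : v.intBin? f v' = some w) :
    Agree G w (a.intBin? f a') := by
  cases ha <;> cases ha'
  case int.int n m => exact .ofInt? h
  all_goals exact .top _

theorem Agree.floatUn {f : F64 → F64} {v w : Val} {a : AVal} (ha : Agree G v a)
    (h : v.floatUn f = some w) : Agree G w (a.floatUn f) := by
  cases ha <;> simp_all [Val.floatUn, AVal.floatUn] <;> subst_vars <;> constructor

theorem Agree.floatBin {f : F64 → F64 → F64} {v v' w : Val} {a a' : AVal} (ha : Agree G v a)
    (ha' : Agree G v' a') (h : v.floatBin f v' = some w) : Agree G w (a.floatBin f a') := by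
  cases ha <;> cases ha' <;> simp_all [Val.floatBin, AVal.floatBin] <;> subst_vars <;> constructor

theorem Agree.add {v v' w : Val} {a a' : AVal} (ha : Agree G v a) (ha' : Agree G v' a')
    (h : v.add v' = some w) : Agree G w (a.add a') := by
  cases ha <;> cases ha' <;> simp_all [Val.add, AVal.add] <;> subst_vars <;> constructor <;>
    assumption

theorem Agree.sub {v v' w : Val} {a a' : AVal} (ha : Agree G v a) (ha' : Agree G v' a')
    (h : v.sub v' = some w) : Agree G w (a.sub a') := by
  cases ha <;> cases ha'
  case int.int => cases h; constructor
  case addrsymbol.int hb _ => cases h; exact .addrsymbol hb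
  all_goals exact .top _

theorem Agree.notbool {v w : Val} {a : AVal} (ha : Agree G v a) (h : v.notbool = some w) :
    Agree G w a.notbool := by
  cases ha <;> simp_all [Val.notbool, AVal.notbool] <;> subst_vars <;> constructor

theorem Agree.intoffloat {v w : Val} {a : AVal} (ha : Agree G v a) (h : v.intoffloat = some w) :
    Agree G w a.intoffloat := by
  cases ha
  case float => exact .ofInt? h
  all_goals exact .top _

theorem Agree.intuoffloat {v w : Val} {a : AVal} (ha : Agree G v a)
    (h : v.intuoffloat = some w) : Agree G w a.intuoffloat := by
  cases ha
  case float => exact .ofInt? h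
  all_goals exact .top _

theorem Agree.floatofint {v w : Val} {a : AVal} (ha : Agree G v a) (h : v.floatofint = some w) :
    Agree G w a.floatofint := by
  cases ha <;> simp_all [Val.floatofint, AVal.floatofint] <;> subst_vars <;> constructor

theorem Agree.floatofintu {v w : Val} {a : AVal} (ha : Agree G v a)
    (h : v.floatofintu = some w) : Agree G w a.floatofintu := by
  cases ha <;> simp_all [Val.floatofintu, AVal.floatofintu] <;> subst_vars <;> constructor

/-- A static outcome exists only if all arguments are known numbers; agreement then turns the
concrete evaluation into the same computation. Definedness of the concrete evaluation is a
conclusion here, not an assumption. -/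
theorem evalCond_eq_static {c : Condition} {vs : List Val} {as : List AVal} {b : Bool}
    (h : List.Forall₂ (Agree G) vs as) (hb : evalCondStatic c as = some b) :
    evalCond c vs = some b := by
  unfold evalCondStatic at hb
  split at hb
  · obtain _ | ⟨h₁, _ | ⟨h₂, _ | _⟩⟩ := h
    rw [h₁.eq_int, h₂.eq_int]; exact hb
  · obtain _ | ⟨h₁, _ | _⟩ := h
    rw [h₁.eq_int]; exact hb
  · obtain _ | ⟨h₁, _ | ⟨h₂, _ | _⟩⟩ := h
    rw [h₁.eq_int, h₂.eq_int]; exact hb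
  · obtain _ | ⟨h₁, _ | _⟩ := h
    rw [h₁.eq_int]; exact hb
  · obtain _ | ⟨h₁, _ | ⟨h₂, _ | _⟩⟩ := h
    rw [h₁.eq_float, h₂.eq_float]; exact hb
  · simp at hb

theorem agree_evalOpStatic {σ : Block} {op : Operation} {vs : List Val} {as : List AVal} {w : Val}
    (h : List.Forall₂ (Agree G) vs as) (hw : evalOp G σ op vs = some w) :
    Agree G w (evalOpStatic op as) := by
  unfold evalOpStatic
  split
  -- Case numbers follow the equations of `evalOpStatic`: 45 is `cmp`, 46 the default `⊤`, 4 is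
  -- `addrsymbol`, 2 and 3 are the numeric constants. The others are unary or binary and have their
  -- own soundness lemmas, apart from `move`.
  case h_45 c as =>
    obtain ⟨b, hb, rfl⟩ := Option.map_eq_some_iff.1 hw
    split
    · rename_i b' hb'
      rw [evalCond_eq_static h hb'] at hb
      cases hb
      exact .int _
    · exact .top _
  case h_46 => exact .top _
  case h_4 =>
    cases h
    obtain ⟨b, hb, rfl⟩ := Option.map_eq_some_iff.1 hw
    exact .addrsymbol hb
  case h_2 | h_3 => cases h; cases hw; constructor
  all_goals first
    | (obtain _ | ⟨h₁, _ | _⟩ := h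
       simp only [evalOp] at hw
       first
         | exact h₁.intUn hw
         | exact h₁.intUn? hw
         | exact h₁.floatUn hw
         | exact h₁.notbool hw
         | exact h₁.intoffloat hw
         | exact h₁.intuoffloat hw
         | exact h₁.floatofint hw
         | exact h₁.floatofintu hw
         | exact h₁.add (.int _) hw
         | (cases hw; exact h₁))
    | (obtain _ | ⟨h₁, _ | ⟨h₂, _ | _⟩⟩ := h
       simp only [evalOp] at hw
       first
         | exact h₁.intBin h₂ hw
         | exact h₁.intBin? h₂ hw
         | exact h₁.floatBin h₂ hw
         | exact h₁.add h₂ hw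
         | exact h₁.sub h₂ hw)

end Agreement

/-! ## Soundness of the static analysis -/

/-- All that the simulation needs from the analysis, whether or not the solver succeeded within its
bound. -/
theorem analyze_spec (N : ℕ) (f : Function) :
    analyze N f f.entrypoint = ⊤ ∧
      ∀ l i, f.code.get l = some i → ∀ s ∈ successors i,
        transfer f l (analyze N f l) ≤ analyze N f s := by
  classical
  unfold analyze
  generalize h : Kildall.solve (α := ARegs) _ _ _ _ _ = o
  cases o with
  | none => exact ⟨rfl, fun _ _ _ _ _ => le_top⟩
  | some A =>
    obtain ⟨h₁, h₂⟩ := Kildall.solve_spec h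
    -- The starting assignment is already `⊤` at the entry point, and the solution lies above it.
    refine ⟨top_le_iff.1 ((le_of_eq ?_).trans (h₁ f.entrypoint)), fun l i hi s hs => ?_⟩
    · simp [Kildall.start]
    · exact h₂ l (by simp [CFG.nodes, hi]) s (by simpa [hi] using hs)

/-- Establishes the invariant on function entry, where nothing is known about the arguments. -/
theorem regsAgree_entrypoint (G : GlobalEnv Function) (N : ℕ) (f : Function) (R : Regs) :
    RegsAgree G R (analyze N f f.entrypoint) := by
  rw [(analyze_spec N f).1]
  exact fun r => .top _

/-- Agreement propagates from a node to its successors along the transfer function. -/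
theorem RegsAgree.successor {G : GlobalEnv Function} {N : ℕ} {f : Function} {l s : Node}
    {i : Instruction} {R : Regs} (h : RegsAgree G R (transfer f l (analyze N f l)))
    (hi : f.code.get l = some i) (hs : s ∈ successors i) : RegsAgree G R (analyze N f s) :=
  h.mono ((analyze_spec N f).2 l i hi s hs)

end Constprop

end CompCert

namespace CompCert

namespace Constprop

open RTL

/-! ## Correctness of operator, condition and addressing mode specialization -/

section Specialization

variable {F : Type} {G : GlobalEnv F} {H : GlobalEnv Function} {σ : Block} {R : Regs} {a : ARegs}

/-- Adding zero is a move on integers and on pointers; definedness of the sum excludes all other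
values. -/
theorem evalOp_addImm {n : I32} {r : Reg} {w : Val} (h : (R r).add (.int n) = some w) :
    evalOp G σ (addImm n r).1 ((addImm n r).2.map R) = some w := by
  unfold addImm
  split_ifs with hn
  · subst hn
    rw [← h]
    change some (R r) = _
    generalize R r = v at h
    cases v <;> simp_all [Val.add]
  · exact h

theorem evalOp_shlImm {n : I32} {r : Reg} {w : Val} (hn : n.toNat < 32)
    (h : (R r).intUn (fun x => x <<< n.toNat) = some w) :
    evalOp G σ (shlImm n r).1 ((shlImm n r).2.map R) = some w := by
  obtain ⟨x, hx, rfl⟩ := Val.exists_int_of_intUn h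
  unfold shlImm
  split_ifs with h0
  · subst h0; simp [evalOp, hx]
  · simp only [evalOp, List.map, hx, Val.intUn, I32.rolm_shl x n hn]

theorem evalOp_shrImm {n : I32} {r : Reg} {w : Val}
    (h : (R r).intUn? (fun x => I32.shr x n) = some w) :
    evalOp G σ (shrImm n r).1 ((shrImm n r).2.map R) = some w := by
  unfold shrImm
  split_ifs with h0
  · obtain ⟨x, y, hx, hy, rfl⟩ := Val.exists_int_of_intUn? h
    subst h0
    simp only [I32.shr, BitVec.toNat_ofNat, BitVec.sshiftRight_zero, Nat.zero_mod] at hy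
    simp_all [evalOp]
  · exact h

theorem evalOp_shruImm {n : I32} {r : Reg} {w : Val} (hn : n.toNat < 32)
    (h : (R r).intUn (fun x => x >>> n.toNat) = some w) :
    evalOp G σ (shruImm n r).1 ((shruImm n r).2.map R) = some w := by
  obtain ⟨x, hx, rfl⟩ := Val.exists_int_of_intUn h
  unfold shruImm
  split_ifs with h0
  · subst h0; simp [evalOp, hx]
  · simp only [evalOp, List.map, hx, Val.intUn, I32.rolm_shru x n hn h0]

theorem evalOp_mulImm {n : I32} {r : Reg} {w : Val} (h : (R r).intUn (· * n) = some w) :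
    evalOp G σ (mulImm n r).1 ((mulImm n r).2.map R) = some w := by
  unfold mulImm
  split_ifs with h0 h1
  -- The replacement by the constant zero is right only because `h` says that the product was
  -- defined, so that the register holds an integer.
  · obtain ⟨x, hx, rfl⟩ := Val.exists_int_of_intUn h
    subst h0; simp [evalOp]
  · obtain ⟨x, hx, rfl⟩ := Val.exists_int_of_intUn h
    subst h1; simp [evalOp, hx]
  · split
    · rename_i k hk
      exact evalOp_shlImm (I32.toNat_of_log2? hk).1 (by simpa only [I32.mul_of_log2? hk] using h)
    · exact h

theorem evalOp_andImm {n : I32} {r : Reg} {w : Val} (h : (R r).intUn (· &&& n) = some w) :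
    evalOp G σ (andImm n r).1 ((andImm n r).2.map R) = some w := by
  unfold andImm
  split_ifs with h0 h1
  · obtain ⟨x, hx, rfl⟩ := Val.exists_int_of_intUn h
    subst h0; simp [evalOp]
  · obtain ⟨x, hx, rfl⟩ := Val.exists_int_of_intUn h
    subst h1; simp only [evalOp, List.map, hx, BitVec.and_allOnes]
  · exact h

theorem evalOp_orImm {n : I32} {r : Reg} {w : Val} (h : (R r).intUn (· ||| n) = some w) :
    evalOp G σ (orImm n r).1 ((orImm n r).2.map R) = some w := by
  unfold orImm
  split_ifs with h0 h1
  · obtain ⟨x, hx, rfl⟩ := Val.exists_int_of_intUn h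
    subst h0; simp [evalOp, hx]
  · obtain ⟨x, hx, rfl⟩ := Val.exists_int_of_intUn h
    subst h1; simp only [evalOp, List.map, BitVec.or_allOnes]
  · exact h

theorem evalOp_xorImm {n : I32} {r : Reg} {w : Val} (h : (R r).intUn (· ^^^ n) = some w) :
    evalOp G σ (xorImm n r).1 ((xorImm n r).2.map R) = some w := by
  unfold xorImm
  split_ifs with h0
  · obtain ⟨x, hx, rfl⟩ := Val.exists_int_of_intUn h
    subst h0; simp [evalOp, hx]
  · exact h

/-- `shrx` is by definition signed division by `1 <<< k`, so no analysis of rounding is needed. For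
`k = 31` that word is negative and `shrx` is undefined; `specOp` then keeps the division. -/
theorem _root_.CompCert.I32.div_of_log2? {n k : I32} (h : I32.log2? n = some k)
    (hk : k.toNat < 31) (x : I32) : I32.div x n = I32.shrx x k := by
  have hn : n ≠ 0#32 := by
    rintro rfl
    exact (pow_pos two_pos k.toNat).ne (I32.toNat_of_log2? h).2
  rw [I32.div, I32.shrx, if_neg hn, if_pos hk, ← I32.eq_shl_of_log2? h]

theorem _root_.CompCert.I32.divu_of_log2? {n k : I32} (h : I32.log2? n = some k) (x : I32) :
    I32.divu x n = some (x >>> k.toNat) := by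
  have hn : n ≠ 0#32 := by
    rintro rfl
    exact (pow_pos two_pos k.toNat).ne (I32.toNat_of_log2? h).2
  rw [I32.divu, if_neg hn, I32.udiv_of_log2? h]

/-- Shifts and unsigned division are partial; once the second operand is a suitable constant they
become total unary operations. -/
theorem _root_.CompCert.Val.intUn?_some (f : I32 → I32) (v : Val) :
    v.intUn? (fun x => some (f x)) = v.intUn f := by
  cases v <;> rfl

theorem evalCond_specCond (hR : RegsAgree H R a) {c : Condition} {args : List Reg} {b : Bool}
    (h : evalCond c (args.map R) = some b) :
    evalCond (specCond a c args).1 ((specCond a c args).2.map R) = some b := by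
  unfold specCond
  split
  · rename_i c r₁ r₂
    have h₁ := hR r₁
    have h₂ := hR r₂
    simp only [List.map, evalCond] at h
    split
    · rename_i n hn
      rw [hn] at h₁
      rw [h₁.eq_int, ← Val.cmp_swap] at h
      exact h
    · rename_i m hm _
      rw [hm] at h₂
      rw [h₂.eq_int] at h
      exact h
    · exact h
  · rename_i c r₁ r₂
    have h₁ := hR r₁
    have h₂ := hR r₂
    simp only [List.map, evalCond] at h
    split
    · rename_i n hn
      rw [hn] at h₁
      rw [h₁.eq_int, ← Val.cmpu_swap] at h
      exact h
    · rename_i m hm _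
      rw [hm] at h₂
      rw [h₂.eq_int] at h
      exact h
    · exact h
  · exact h

theorem evalOp_specOp (hR : RegsAgree H R a) {op : Operation} {args : List Reg} {w : Val}
    (h : evalOp G σ op (args.map R) = some w) :
    evalOp G σ (specOp a op args).1 ((specOp a op args).2.map R) = some w := by
  have hint : ∀ {r n}, a r = .int n → R r = .int n := fun {r n} hr => by
    have := hR r
    rw [hr] at this
    exact this.eq_int
  unfold specOp
  -- The cases are `add`, `sub`, `mul`, `div`, `divu`, `and`, `or`, `xor`, `shl`, `shr`, `shru`,
  -- `cmp` and the default. Each rewrites the evaluation with the known operand; commutative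
  -- operators first move it to the right.
  split <;> try simp only [List.map, evalOp] at h
  · split
    · rename_i n hn
      rw [hint hn, Val.add_int_comm] at h
      exact evalOp_addImm h
    · rename_i m hm _
      rw [hint hm] at h
      exact evalOp_addImm h
    · exact h
  · split
    · rename_i n hn
      rw [hint hn, Val.sub_int_left] at h
      exact h
    · rename_i m hm _
      rw [hint hm, ← Val.add_int_neg] at h
      exact evalOp_addImm h
    · exact h
  · split
    · rename_i n hn
      rw [hint hn, Val.intBin_comm BitVec.mul_comm, Val.intBin_int_right] at h
      exact evalOp_mulImm h
    · rename_i m hm _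
      rw [hint hm, Val.intBin_int_right] at h
      exact evalOp_mulImm h
    · exact h
  · split
    · rename_i m hm
      split
      · rename_i k hk
        split_ifs with hk'
        · rw [hint hm, Val.intBin?_int_right] at h
          simp only [I32.div_of_log2? hk hk'] at h
          exact h
        · exact h
      · exact h
    · exact h
  · split
    · rename_i m hm
      split
      · rename_i k hk
        rw [hint hm, Val.intBin?_int_right] at h
        simp only [I32.divu_of_log2? hk, Val.intUn?_some] at h
        exact evalOp_shruImm (I32.toNat_of_log2? hk).1 h
      · exact h
    · exact h
  · split
    · rename_i n hn
      rw [hint hn, Val.intBin_comm BitVec.and_comm, Val.intBin_int_right] at h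
      exact evalOp_andImm h
    · rename_i m hm _
      rw [hint hm, Val.intBin_int_right] at h
      exact evalOp_andImm h
    · exact h
  · split
    · rename_i n hn
      rw [hint hn, Val.intBin_comm BitVec.or_comm, Val.intBin_int_right] at h
      exact evalOp_orImm h
    · rename_i m hm _
      rw [hint hm, Val.intBin_int_right] at h
      exact evalOp_orImm h
    · exact h
  · split
    · rename_i n hn
      rw [hint hn, Val.intBin_comm BitVec.xor_comm, Val.intBin_int_right] at h
      exact evalOp_xorImm h
    · rename_i m hm _
      rw [hint hm, Val.intBin_int_right] at h
      exact evalOp_xorImm h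
    · exact h
  · split
    · rename_i m hm
      split_ifs with hlt
      · rw [hint hm, Val.intBin?_int_right] at h
        simp only [I32.shl, if_pos hlt, Val.intUn?_some] at h
        exact evalOp_shlImm hlt h
      · exact h
    · exact h
  · split
    · rename_i m hm
      split_ifs with hlt
      · rw [hint hm, Val.intBin?_int_right] at h
        exact evalOp_shrImm h
      · exact h
    · exact h
  · split
    · rename_i m hm
      split_ifs with hlt
      · rw [hint hm, Val.intBin?_int_right] at h
        simp only [I32.shru, if_pos hlt, Val.intUn?_some] at h
        exact evalOp_shruImm hlt h
      · exact h
    · exact h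
  · obtain ⟨b, hb, rfl⟩ := Option.map_eq_some_iff.1 h
    simp only [evalOp, evalCond_specCond hR hb, Option.map_some]
  · exact h

/-- A known symbol address is a pointer into the block of that symbol, so a symbolic mode recomputes
it from the environment; offsets are added as before. -/
theorem evalMode_specMode (hsymb : G.symbol = H.symbol) (hR : RegsAgree H R a) {mode : Mode}
    {args : List Reg} {w : Val} (h : evalMode G σ mode (args.map R) = some w) :
    evalMode G σ (specMode a mode args).1 ((specMode a mode args).2.map R) = some w := by
  have hint : ∀ {r n}, a r = .int n → R r = .int n := fun {r n} hr => by
    have := hR r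
    rw [hr] at this
    exact this.eq_int
  have hptr : ∀ {r id δ}, a r = .addrsymbol id δ → ∃ b, R r = .ptr b δ ∧ G.symbol id = some b :=
    fun {r id δ} hr => by
      have := hR r
      rw [hr] at this
      rw [hsymb]
      exact this.exists_ptr
  unfold specMode
  split
  · split
    · rename_i hr
      obtain ⟨b, hb, hs⟩ := hptr hr
      simpa [evalMode, hb, hs] using h
    · exact h
  · rename_i r₁ r₂
    simp only [List.map] at h
    split
    · rename_i h₁ h₂
      obtain ⟨b, hb, hs⟩ := hptr h₁
      simpa [evalMode, hb, hs, hint h₂] using h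
    · rename_i h₁ h₂
      obtain ⟨b, hb, hs⟩ := hptr h₂
      simpa [evalMode, hb, hs, hint h₁] using h
    · rename_i h₁ _
      obtain ⟨b, hb, hs⟩ := hptr h₁
      rw [hb] at h
      -- The other register must hold an integer, as two-register addressing of a pointer is defined
      -- only then; this is what `based` requires.
      cases h₂ : R r₂ <;> simp_all [evalMode]
    · rename_i h₂ _ _
      obtain ⟨b, hb, hs⟩ := hptr h₂
      rw [hb] at h
      cases h₁ : R r₁ <;> simp_all [evalMode]
    · rename_i h₁ _
      rw [hint h₁] at h
      cases h₂ : R r₂ <;> simp_all [evalMode]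
    · rename_i h₂ _ _
      rw [hint h₂] at h
      cases h₁ : R r₁ <;> simp_all [evalMode]
    · exact h
  · rename_i r
    split
    · rename_i hr
      simpa [evalMode, hint hr] using h
    · exact h
  · exact h

/-- Evaluation consults the environment only for symbols, which lets it pass from the original
program to the transformed one. -/
theorem evalMode_congr {F' : Type} {G' : GlobalEnv F'} (hsymb : G'.symbol = G.symbol) (σ : Block)
    (mode : Mode) (vs : List Val) : evalMode G' σ mode vs = evalMode G σ mode vs := by
  unfold evalMode
  rw [hsymb]

theorem evalOp_congr {F' : Type} {G' : GlobalEnv F'} (hsymb : G'.symbol = G.symbol) (σ : Block)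
    (op : Operation) (vs : List Val) : evalOp G' σ op vs = evalOp G σ op vs := by
  unfold evalOp
  rw [hsymb]

end Specialization

end Constprop

end CompCert

namespace CompCert

/-! ## Transformation of programs -/

section TransfProgram

variable {F₁ F₂ : Type} {transf : F₁ → Except String F₂}

theorem forall₂_of_transfFunctions {fs : List (Ident × FunDef F₁)} {fs' : List (Ident × FunDef F₂)}
    (h : transfFunctions transf fs = .ok fs') :
    List.Forall₂ (fun p p' => p.1 = p'.1 ∧ transfFunDef transf p.2 = .ok p'.2) fs fs' := by
  induction fs generalizing fs' with
  | nil => cases h; exact .nil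
  | cons p fs ih =>
    obtain ⟨id, fd⟩ := p
    unfold transfFunctions at h
    cases hfd : transfFunDef transf fd with
    | error e => simp [hfd, Except.bind] at h
    | ok fd' =>
      cases hfs : transfFunctions transf fs with
      | error e => simp [hfd, hfs, Except.bind, Except.map] at h
      | ok fs₀ =>
        simp only [hfd, hfs, Except.bind, Except.map, Except.ok.injEq] at h
        subst h
        exact .cons ⟨rfl, hfd⟩ (ih hfs)

theorem transfProgram_spec {P : Program F₁} {P' : Program F₂}
    (h : transfProgram transf P = .ok P') :
    P'.vars = P.vars ∧ P'.main = P.main ∧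
      List.Forall₂ (fun p p' => p.1 = p'.1 ∧ transfFunDef transf p.2 = .ok p'.2)
        P.functs P'.functs := by
  unfold transfProgram at h
  cases hfs : transfFunctions transf P.functs with
  | error e => simp [hfs, Except.map] at h
  | ok fs =>
    simp only [hfs, Except.map, Except.ok.injEq] at h
    subst h
    exact ⟨rfl, rfl, forall₂_of_transfFunctions hfs⟩

/-- The block of a symbol depends only on the position of its name among the functions or variables,
and these lists keep their names and order. -/
theorem symbol_globalenv_transfProgram {P : Program F₁} {P' : Program F₂}
    (h : transfProgram transf P = .ok P') :
    (globalenv P').symbol = (globalenv P).symbol := by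
  obtain ⟨hv, -, hf⟩ := transfProgram_spec h
  have key : ∀ id, P'.functs.findIdx? (fun p => p.1 == id) =
      P.functs.findIdx? (fun p => p.1 == id) := fun id => by
    generalize P.functs = fs, P'.functs = fs' at hf
    induction hf with
    | nil => rfl
    | cons hp _ ih => simp only [List.findIdx?_cons, hp.1, ih]
  funext id
  simp only [globalenv, key, hv]

theorem funct_globalenv_transfProgram {P : Program F₁} {P' : Program F₂}
    (h : transfProgram transf P = .ok P') {b : Block} {fd : FunDef F₁}
    (hb : (globalenv P).funct b = some fd) :
    ∃ fd', (globalenv P').funct b = some fd' ∧ transfFunDef transf fd = .ok fd' := by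
  obtain ⟨-, -, hf⟩ := transfProgram_spec h
  simp only [globalenv] at hb ⊢
  split_ifs at hb ⊢ with hneg
  generalize (-b - 1).toNat = i at hb
  obtain ⟨p, hp, rfl⟩ := Option.map_eq_some_iff.1 hb
  obtain ⟨hi, rfl⟩ := List.getElem?_eq_some_iff.1 hp
  have hi' : i < P'.functs.length := hf.length_eq ▸ hi
  exact ⟨P'.functs[i].2, by simp [hi'], (hf.get hi hi').2⟩

theorem initmem_transfProgram {P : Program F₁} {P' : Program F₂}
    (h : transfProgram transf P = .ok P') : initmem P' = initmem P := by
  unfold initmem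
  rw [(transfProgram_spec h).1]

end TransfProgram

/-! ## Preservation of behaviors by lock-step simulations -/

namespace TransSem

variable {L L' : TransSem} {sim : L.State → L'.State → Prop}

theorem Star.simulation (hstep : ∀ S₁ t S₂ S₁', L.step S₁ t S₂ → sim S₁ S₁' →
      ∃ S₂', L'.step S₁' t S₂' ∧ sim S₂ S₂')
    {S₁ S₂ : L.State} {t : Trace} (h : L.Star S₁ t S₂) {S₁' : L'.State} (hs : sim S₁ S₁') :
    ∃ S₂', L'.Star S₁' t S₂' ∧ sim S₂ S₂' := by
  induction h generalizing S₁' with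
  | refl S => exact ⟨S₁', .refl _, hs⟩
  | step h₁ _ ih =>
    obtain ⟨S₂', h₂, hs₂⟩ := hstep _ _ _ _ h₁ hs
    obtain ⟨S₃', h₃, hs₃⟩ := ih hs₂
    exact ⟨S₃', .step h₂ h₃, hs₃⟩

theorem Forever.simulation (hstep : ∀ S₁ t S₂ S₁', L.step S₁ t S₂ → sim S₁ S₁' →
      ∃ S₂', L'.step S₁' t S₂' ∧ sim S₂ S₂')
    {S : L.State} {T : TraceInf} (h : L.Forever S T) {S' : L'.State} (hs : sim S S') :
    L'.Forever S' T := by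
  obtain ⟨X, hX, hXstep⟩ := h
  -- Coinduction: the invariant `X` of the source is transported along `sim`.
  refine ⟨fun S' T => ∃ S, sim S S' ∧ X S T, ⟨S, hs, hX⟩, ?_⟩
  rintro S₁' T₁ ⟨S₁, hs₁, hX₁⟩
  obtain ⟨t, S₂, T₂, h₁, rfl, hX₂⟩ := hXstep S₁ T₁ hX₁
  obtain ⟨S₂', h₂, hs₂⟩ := hstep _ _ _ _ h₁ hs₁
  exact ⟨t, S₂', T₂, h₂, rfl, S₂, hs₂, hX₂⟩

/-- A forward simulation says nothing about a stuck source state, so only termination and divergence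
are transferred. -/
theorem Behaves.simulation
    (hinit : ∀ S, L.initial S → ∃ S', L'.initial S' ∧ sim S S')
    (hfinal : ∀ S S' n, sim S S' → L.final S n → L'.final S' n)
    (hstep : ∀ S₁ t S₂ S₁', L.step S₁ t S₂ → sim S₁ S₁' →
      ∃ S₂', L'.step S₁' t S₂' ∧ sim S₂ S₂')
    {B : Behavior} (hB : B ∉ Wrong) (h : L.Behaves B) : L'.Behaves B := by
  cases h with
  | converges hi hst hf =>
    obtain ⟨S₁', hi', hs₁⟩ := hinit _ hi
    obtain ⟨S₂', hst', hs₂⟩ := hst.simulation hstep hs₁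
    exact .converges hi' hst' (hfinal _ _ _ hs₂ hf)
  | diverges hi hfe =>
    obtain ⟨S', hi', hs⟩ := hinit _ hi
    exact .diverges hi' (hfe.simulation hstep hs)
  | goeswrong => exact absurd ⟨_, rfl⟩ hB

end TransSem

namespace Constprop

open RTL

/-! ## The simulation diagram -/

section Simulation

variable {N : ℕ} {G G' : GlobalEnv Function}

/-- The rules for calls check the signature of the callee. -/
theorem sig_of_transfFunDef {fd fd' : FunDef Function}
    (h : transfFunDef (transf N) fd = .ok fd') : fd'.sig = fd.sig := by
  cases fd <;> cases h <;> rfl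

theorem get_code_of_transf {f f' : Function} (h : transf N f = .ok f') {l : Node} {i : Instruction}
    (hi : f.code.get l = some i) :
    f'.code.get l = some (transfInstr (analyze N f l) i) := by
  cases h
  simp [CFG.map, hi]

theorem findFunction_transf (hsymb : G'.symbol = G.symbol)
    (hfunct : ∀ b fd, G.funct b = some fd →
      ∃ fd', G'.funct b = some fd' ∧ transfFunDef (transf N) fd = .ok fd')
    {R : Regs} {fn : Reg ⊕ Ident} {fd : FunDef Function} (h : findFunction G R fn = some fd) :
    ∃ fd', findFunction G' R fn = some fd' ∧ transfFunDef (transf N) fd = .ok fd' := by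
  rcases fn with r | id
  · simp only [findFunction] at h ⊢
    split at h
    · split_ifs at h ⊢ with hδ
      exact hfunct _ _ h
    · simp at h
  · simp only [findFunction, hsymb] at h ⊢
    obtain ⟨b, hb, h⟩ := Option.bind_eq_some_iff.1 h
    simp only [hb, Option.bind_some]
    exact hfunct _ _ h

/-- The transformed `op` instruction at a node computes the same value. -/
theorem exists_transfInstr_op (hsymb : G'.symbol = G.symbol) {a : ARegs} {R : Regs} {σ : Block}
    (hR : RegsAgree G R a) {op : Operation} {args : List Reg} {v : Val}
    (h : evalOp G σ op (args.map R) = some v) (r : Reg) (l : Node) :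
    ∃ op' args', transfInstr a (.op op args r l) = .op op' args' r l ∧
      evalOp G' σ op' (args'.map R) = some v := by
  -- The computed value agrees with the static result, so a known static result leaves only one
  -- possible value.
  have hv := agree_evalOpStatic (hR.forall₂ args) h
  unfold transfInstr
  simp only
  split
  · rename_i hn
    rw [hn] at hv
    exact ⟨_, _, rfl, by rw [hv.eq_int]; rfl⟩
  · rename_i hx
    rw [hx] at hv
    exact ⟨_, _, rfl, by rw [hv.eq_float]; rfl⟩
  · rename_i hs
    rw [hs] at hv
    obtain ⟨b, rfl, hb⟩ := hv.exists_ptr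
    exact ⟨_, _, rfl, by simp [evalOp, hsymb, hb]⟩
  · exact ⟨_, _, rfl, by rw [evalOp_congr hsymb]; exact evalOp_specOp hR h⟩

/-- For steps inside a function there are two obligations: the rewritten instruction makes the same
step, and agreement reaches the successor through the transfer function. -/
theorem step_simulation (hsymb : G'.symbol = G.symbol)
    (hfunct : ∀ b fd, G.funct b = some fd →
      ∃ fd', G'.funct b = some fd' ∧ transfFunDef (transf N) fd = .ok fd')
    {S₁ S₂ S₁' : State} {t : Trace} (hstep : Step G S₁ t S₂) (hs : MatchStates N G S₁ S₁') :
    ∃ S₂', Step G' S₁' t S₂' ∧ MatchStates N G S₂ S₂' := by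
  cases hstep with
  | nop hi =>
    obtain ⟨hf, hstk, hR⟩ := hs
    refine ⟨_, .nop (get_code_of_transf hf hi), .regular hf hstk ?_⟩
    exact .successor (by simpa [transfer, hi] using hR) hi (by simp [successors])
  | op hi hv =>
    obtain ⟨hf, hstk, hR⟩ := hs
    obtain ⟨op', args', he, hv'⟩ := exists_transfInstr_op hsymb hR hv _ _
    refine ⟨_, .op ((get_code_of_transf hf hi).trans (congrArg some he)) hv',
      .regular hf hstk ?_⟩
    refine .successor ?_ hi (by simp [successors])
    simpa only [transfer, hi] using hR.update (agree_evalOpStatic (hR.forall₂ _) hv)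
  | load hi ha hv =>
    obtain ⟨hf, hstk, hR⟩ := hs
    refine ⟨_, .load (get_code_of_transf hf hi)
      ((evalMode_congr hsymb _ _ _).trans (evalMode_specMode rfl hR ha)) hv, .regular hf hstk ?_⟩
    refine .successor ?_ hi (by simp [successors])
    simpa only [transfer, hi] using hR.update (x := ⊤) (.top _)
  | store hi ha hm =>
    obtain ⟨hf, hstk, hR⟩ := hs
    refine ⟨_, .store (get_code_of_transf hf hi)
      ((evalMode_congr hsymb _ _ _).trans (evalMode_specMode rfl hR ha)) hm, .regular hf hstk ?_⟩
    exact .successor (by simpa [transfer, hi] using hR) hi (by simp [successors])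
  | call hi hfn hsig =>
    obtain ⟨hf, hstk, hR⟩ := hs
    obtain ⟨fd', hfn', hfd⟩ := findFunction_transf hsymb hfunct hfn
    refine ⟨_, .call (get_code_of_transf hf hi) hfn' ((sig_of_transfFunDef hfd).trans hsig),
      .call hfd (.cons hf hstk fun v => .successor ?_ hi (by simp [successors]))⟩
    -- The transfer function sends the result register to `⊤`, so the frame is valid for every value
    -- `v` that the callee may return.
    simpa only [transfer, hi] using hR.update (x := ⊤) (.top _)
  | tailcall hi hfn hsig =>
    obtain ⟨hf, hstk, hR⟩ := hs
    obtain ⟨fd', hfn', hfd⟩ := findFunction_transf hsymb hfunct hfn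
    exact ⟨_, .tailcall (get_code_of_transf hf hi) hfn' ((sig_of_transfFunDef hfd).trans hsig),
      .call hfd hstk⟩
  | condTrue hi hc =>
    obtain ⟨hf, hstk, hR⟩ := hs
    have hi' := get_code_of_transf hf hi
    refine ⟨_, ?_, .regular hf hstk
      (.successor (by simpa [transfer, hi] using hR) hi (by simp [successors]))⟩
    unfold transfInstr at hi'
    simp only at hi'
    split at hi'
    -- Known true: the branch is now a `nop`. Known false contradicts the step taken. Unknown: the
    -- specialized condition still evaluates to true.
    · exact .nop hi'
    · rename_i hb
      rw [evalCond_eq_static (hR.forall₂ _) hb] at hc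
      simp at hc
    · exact .condTrue hi' (evalCond_specCond hR hc)
  | condFalse hi hc =>
    obtain ⟨hf, hstk, hR⟩ := hs
    have hi' := get_code_of_transf hf hi
    refine ⟨_, ?_, .regular hf hstk
      (.successor (by simpa [transfer, hi] using hR) hi (by simp [successors]))⟩
    unfold transfInstr at hi'
    simp only at hi'
    split at hi'
    · rename_i hb
      rw [evalCond_eq_static (hR.forall₂ _) hb] at hc
      simp at hc
    · exact .nop hi'
    · exact .condFalse hi' (evalCond_specCond hR hc)
  | retNone hi =>
    obtain ⟨hf, hstk, hR⟩ := hs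
    exact ⟨_, .retNone (get_code_of_transf hf hi), .ret hstk⟩
  | retSome hi =>
    obtain ⟨hf, hstk, hR⟩ := hs
    exact ⟨_, .retSome (get_code_of_transf hf hi), .ret hstk⟩
  | @internal _ f _ _ _ _ ha =>
    obtain _ | ⟨hfd, hstk⟩ := hs
    cases hfd
    exact ⟨_, .internal ha, .regular (f := f) rfl hstk (regsAgree_entrypoint _ _ _ _)⟩
  | external he =>
    obtain _ | ⟨hfd, hstk⟩ := hs
    cases hfd
    exact ⟨_, .external he, .ret hstk⟩
  | ret =>
    obtain _ | _ | hstk := hs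
    obtain _ | ⟨hf, hstk, hR⟩ := hstk
    exact ⟨_, .ret, .regular hf hstk (hR _)⟩

theorem final_simulation {S S' : State} {n : I32} (hs : MatchStates N G S S') (h : Final S n) :
    Final S' n := by
  cases h
  obtain _ | _ | hstk := hs
  cases hstk
  exact .intro

theorem initial_simulation {P P' : Program Function} (hP : transfProgram (transf N) P = .ok P')
    {S : State} (h : Initial P S) :
    ∃ S', Initial P' S' ∧ MatchStates N (globalenv P) S S' := by
  obtain ⟨hb, hfd⟩ := h
  obtain ⟨fd', hfd', ht⟩ := funct_globalenv_transfProgram hP hfd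
  refine ⟨_, .intro (b := _) ?_ hfd', ?_⟩
  · rw [symbol_globalenv_transfProgram hP, (transfProgram_spec hP).2.1, hb]
  · rw [initmem_transfProgram hP]
    exact .call ht .nil

/-- Turns the existence of a matching initial state into matching with every initial state. -/
theorem _root_.CompCert.RTL.Initial.unique {P : Program Function} {S S' : State}
    (h : Initial P S) (h' : Initial P S') : S = S' := by
  obtain ⟨hb, hfd⟩ := h
  obtain ⟨hb', hfd'⟩ := h'
  rw [hb, Option.some.injEq] at hb'
  subst hb'
  rw [hfd, Option.some.injEq] at hfd'
  rw [hfd']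

end Simulation

end Constprop

end CompCert

theorem lemmal (N : ℕ) (P P' : CompCert.Program CompCert.RTL.Function)
    (hP : CompCert.transfProgram (CompCert.Constprop.transf N) P = .ok P') :
    -- initial states are related
    (∀ S₁ S₁', CompCert.RTL.Initial P S₁ → CompCert.RTL.Initial P' S₁' →
      CompCert.Constprop.MatchStates N (CompCert.globalenv P) S₁ S₁') ∧
    -- final states are related
    (∀ S₁ S₁' n, CompCert.Constprop.MatchStates N (CompCert.globalenv P) S₁ S₁' →
      CompCert.RTL.Final S₁ n → CompCert.RTL.Final S₁' n) ∧
    -- lock-step simulation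
    (∀ S₁ t S₂ S₁', CompCert.RTL.Step (CompCert.globalenv P) S₁ t S₂ →
      CompCert.Constprop.MatchStates N (CompCert.globalenv P) S₁ S₁' →
      ∃ S₂', CompCert.RTL.Step (CompCert.globalenv P') S₁' t S₂' ∧
        CompCert.Constprop.MatchStates N (CompCert.globalenv P) S₂ S₂') ∧
    -- semantic preservation
    (∀ B, B ∉ CompCert.Wrong → (CompCert.RTL.sem P).Behaves B → (CompCert.RTL.sem P').Behaves B) := by
  open CompCert CompCert.Constprop in
  have hstep : ∀ S₁ t S₂ S₁', RTL.Step (globalenv P) S₁ t S₂ →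
      MatchStates N (globalenv P) S₁ S₁' →
      ∃ S₂', RTL.Step (globalenv P') S₁' t S₂' ∧ MatchStates N (globalenv P) S₂ S₂' :=
    fun _ _ _ _ h hs => step_simulation (symbol_globalenv_transfProgram hP)
      (fun _ _ => funct_globalenv_transfProgram hP) h hs
  refine ⟨fun S₁ S₁' h h' => ?_, fun _ _ _ => CompCert.Constprop.final_simulation, hstep,
    fun B hB h => ?_⟩
  · obtain ⟨S', hS', hs⟩ := CompCert.Constprop.initial_simulation hP h
    rwa [h'.unique hS']
  · exact CompCert.TransSem.Behaves.simulation (L := CompCert.RTL.sem P)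
      (L' := CompCert.RTL.sem P')
      (sim := CompCert.Constprop.MatchStates N (CompCert.globalenv P))
      (fun _ => CompCert.Constprop.initial_simulation hP)
      (fun _ _ _ => CompCert.Constprop.final_simulation) hstep hB h
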